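/- **Setting (linear C2L model).** Let $u_0,u_1,\dots$ (latent confounders), $e_{s_0},e_{s_1},\dots$ (state noises, $e_{s_0}$ being the initial state) and $e_{a_0},e_{a_1},\dots$ (action noises) be mutually independent real random variables, where the $u_j$ are identically distributed, the $u_j$ and $e_{a_j}$ are integrable with mean zero, and no $e_{s_j}$ with $j\ge 1$ is almost surely constant. Let $\tau\in\mathbb N$ and let $\rho_{ss},\rho_{as},\rho_{sa},\rho_0,\dots,\rho_\tau$ be real numbers. States and actions are given by $s_0=e_{s_0}$ and $$s_{r+1}=\rho_{ss}\,s_r+\rho_{as}\,a_r+e_{s_{r+1}},\qquad a_r=\rho_{sa}\,s_r+\sum_{0\le i\le\min(\tau,r)}\rho_i\,u_{r-i}+e_{a_r}\qquad(r\ge 0).$$ The causal graph has the nodes $s_r,a_r,u_r$ and an edge for every nonzero direct effect. **Definitions.** Let $k<t$. * $s_k$ is a *valid instrument* for the effect of $s_t$ on $a_t$ if (relevance) $s_k$ and $s_t$ are not independent; (exclusion) every directed path from $s_k$ to $a_t$ passes through $s_t$; (exogeneity) $s_k$ is independent of the family of those confounders $u_{t-i}$, $0\le i\le\min(\tau,t)$,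 with $\rho_i\neq0$. * $\{s_t,a_t\,||\,s_k\}$ satisfies the *AB Criterion* if for some nonzero linear map $l:\mathbb R\to\mathbb R$ the residual $\mathcal R=a_t-l(s_t)$ is integrable, satisfies $\mathbb E[\mathcal R\mid s_k]=0$ almost surely, and is independent of $s_k$. * *Partial Non-Gaussianity*: some $u_j$ is non-Gaussian and has a directed path to $s_t$, or $e_{s_k}$ is non-Gaussian (constants count as Gaussian). **Theorem.** Assume that $\rho_{sa}\ne0$, that $\rho_{ss}+\rho_{as}\rho_{sa}\neq 0$ (the one-step effect of a state on the next one), that the laws of $s_k$ and of the $u_j$ have everywhere positive, twice differentiable densities on $\mathbb R$, and that Partial Non-Gaussianity holds. If the confounders are Gaussian, assume moreover that their contributions do not cancel exactly: with $c_j$ the coefficient of $u_j$ in the expansion of $s_k$ in the confounders and noise terms, the sum $\sum_{\max(0,t-\tau)\le j\le t}c_j\,\rho_{t-j}$ vanishes only if all its terms vanish. Then $\{s_t,a_t\,||\,s_k\}$ satisfies the AB Criterion if and only if $s_k$ is a valid instrument for the effect of $s_t$ on $a_t$. -/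

import Mathlib

open MeasureTheory ProbabilityTheory

/-- The linear confounded causal imitation learning model with scalar states and actions.
Time starts at `0`, there are no confounders before time `0`, and the root `eS 0` is the
initial state; its law is not related to that of the later state noises. -/
structure LinearC2L (Ω : Type*) [MeasurableSpace Ω] (μ : Measure Ω) where
  /-- number of time steps during which a confounder keeps acting -/
  τ : ℕ
  /-- direct effect of `s_{t-1}` on `s_t` -/
  ρss : ℝ
  /-- direct effect of `a_{t-1}` on `s_t` -/
  ρas : ℝ
  /-- direct effect of `s_t` on `a_t` (the linear policy) -/
  ρsa : ℝ
  /-- `ρua i` is the direct effect of `u_{t-i}` on `a_t`; only `i ≤ τ` is ever used -/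
  ρua : ℕ → ℝ
  /-- latent confounders -/
  u : ℕ → Ω → ℝ
  /-- state noises -/
  eS : ℕ → Ω → ℝ
  /-- action noises -/
  eA : ℕ → Ω → ℝ
  measurable_u : ∀ j, Measurable (u j)
  measurable_eS : ∀ j, Measurable (eS j)
  measurable_eA : ∀ j, Measurable (eA j)
  /-- all confounders and noise terms are mutually independent -/
  indep : iIndepFun (Sum.elim u (Sum.elim eS eA)) μ
  /-- the confounders are copies of one latent variable -/
  identDistrib_u : ∀ j, IdentDistrib (u j) (u 0) μ μ
  integrable_u : ∀ j, Integrable (u j) μ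
  mean_u : ∀ j, ∫ ω, u j ω ∂μ = 0
  integrable_eA : ∀ j, Integrable (eA j) μ
  mean_eA : ∀ j, ∫ ω, eA j ω ∂μ = 0
  /-- the state noises are genuinely random (the initial state may be deterministic) -/
  eS_nondegenerate : ∀ j, 1 ≤ j → ¬ ∃ c : ℝ, eS j =ᵐ[μ] fun _ => c

namespace LinearC2L

/-- The nodes of the causal graph: states, actions, latent confounders. -/
inductive Node where
  | S (i : ℕ)
  | A (i : ℕ)
  | U (j : ℕ)

variable {Ω : Type*} [MeasurableSpace Ω] {μ : Measure Ω} (M : LinearC2L Ω μ)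

/-- The confounding term `ρua 0 * u_t + … + ρua τ * u_{t-τ}` of `a_t`. The truncated subtraction
keeps the time indices nonnegative. -/
noncomputable def confounding (t : ℕ) (ω : Ω) : ℝ :=
  ∑ j ∈ Finset.Icc (t - M.τ) t, M.ρua (t - j) * M.u j ω

/-- The state `s_t`. -/
noncomputable def s : ℕ → Ω → ℝ
  | 0 => M.eS 0
  | t + 1 => fun ω =>
      M.ρss * s t ω + M.ρas * (M.ρsa * s t ω + M.confounding t ω + M.eA t ω) + M.eS (t + 1) ω

/-- The action `a_t`. -/
noncomputable def a (t : ℕ) (ω : Ω) : ℝ :=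
  M.ρsa * M.s t ω + M.confounding t ω + M.eA t ω

theorem s_succ (t : ℕ) (ω : Ω) :
    M.s (t + 1) ω = M.ρss * M.s t ω + M.ρas * M.a t ω + M.eS (t + 1) ω := rfl

/-- The edges of the causal graph: the nonzero direct effects. -/
inductive Edge : Node → Node → Prop
  | ss (i : ℕ) : M.ρss ≠ 0 → Edge (.S i) (.S (i + 1))
  | as (i : ℕ) : M.ρas ≠ 0 → Edge (.A i) (.S (i + 1))
  | sa (i : ℕ) : M.ρsa ≠ 0 → Edge (.S i) (.A i)
  | ua (j i : ℕ) : i ≤ M.τ → M.ρua i ≠ 0 → Edge (.U j) (.A (j + i))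

/-- The times `j` of the confounders `u_j` that act on `a_t`. -/
def confounderTimes (t : ℕ) : Set ℕ := {j | j ∈ Finset.Icc (t - M.τ) t ∧ M.ρua (t - j) ≠ 0}

/-- `s_k` is a valid instrument for the effect of the treatment `s_t` on the outcome `a_t`. -/
structure IsValidIV (k t : ℕ) : Prop where
  /-- the instrument is associated with the treatment -/
  relevance : ¬ IndepFun (M.s k) (M.s t) μ
  /-- every directed path from the instrument to the outcome passes through the treatment -/
  exclusion : ¬ Relation.TransGen (fun x y => M.Edge x y ∧ x ≠ Node.S t) (.S k) (.A t)
  /-- the instrument is independent of the family of the latent confounders of the outcome -/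
  exogeneity : IndepFun (M.s k) (fun ω (j : M.confounderTimes t) => M.u j ω) μ

/-- The auxiliary-based criterion for `{s_t, a_t || s_k}`: with a nonzero linear `l`, the residual
`a_t - l s_t` has conditional mean zero given `s_k` and is independent of `s_k`. -/
def ABCriterion (k t : ℕ) : Prop :=
  ∃ l : ℝ →ₗ[ℝ] ℝ, l ≠ 0 ∧
    Integrable (fun ω => M.a t ω - l (M.s t ω)) μ ∧
    μ[fun ω => M.a t ω - l (M.s t ω) | MeasurableSpace.comap (M.s k) inferInstance] =ᵐ[μ] 0 ∧
    IndepFun (fun ω => M.a t ω - l (M.s t ω)) (M.s k) μ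

/-- Partial non-Gaussianity: some non-Gaussian confounder affects `s_t`, or the noise term of
`s_k` is non-Gaussian. -/
def PartialNonGaussianity (k t : ℕ) : Prop :=
  (∃ j, ¬ HasGaussianLaw (M.u j) μ ∧ Relation.TransGen M.Edge (.U j) (.S t)) ∨
    ¬ HasGaussianLaw (M.eS k) μ

/-- The total effect of `u_j` on `s_k`, that is, the coefficient of `u_j` when `s_k` is expanded in
the confounders and noise terms. -/
noncomputable def confounderEffect (j : ℕ) : ℕ → ℝ
  | 0 => 0
  | k + 1 => (M.ρss + M.ρas * M.ρsa) * confounderEffect j k +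
      M.ρas * (if j ∈ Finset.Icc (k - M.τ) k then M.ρua (k - j) else 0)

/-- The contributions of the paths `s_k ← … ← u_j → a_t` through the different confounders `u_j`
do not cancel exactly: their sum vanishes only if each of them does. -/
def NoCancellation (k t : ℕ) : Prop :=
  ∑ j ∈ Finset.Icc (t - M.τ) t, M.confounderEffect j k * M.ρua (t - j) = 0 →
    ∀ j ∈ Finset.Icc (t - M.τ) t, M.confounderEffect j k * M.ρua (t - j) = 0

end LinearC2L

/-- `ν` has a positive twice differentiable density with respect to Lebesgue measure. -/
def HasPosTwiceDiffDensity (ν : Measure ℝ) : Prop :=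
  ∃ p : ℝ → ℝ, (∀ x, 0 < p x) ∧ Differentiable ℝ p ∧ Differentiable ℝ (deriv p) ∧
    ν = volume.withDensity (fun x => ENNReal.ofReal (p x))

/-! The states and the disturbance `D_t = a_t - ρsa * s_t` are finite linear forms in independent
roots, and a residual is `(ρsa - l) * s_t + D_t`. So the question is which linear forms in
independent variables can be independent. Darmois–Skitovich (`hasGaussianLaw_of_indepFun_sum`) makes
every shared root Gaussian, and `sum_mul_variance_eq_zero_of_indepFun` then makes the covariance
over the shared roots vanish.

Each noise root of `s_k` enters `m * s_t + q * D_t` with `m * β ^ (t - k)` times its coefficient in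
`s_k`, where `β` is the one-step state effect. If `m ≠ 0`, independence from `s_k` makes `eS k`
Gaussian. Partial non-Gaussianity then makes all confounders non-Gaussian, so none is shared, and
the covariance is a nonzero multiple of a sum of squares times variances. Hence `eS k` is constant,
which is excluded. Therefore the AB criterion forces `l = ρsa`, and `m = 1`, `q = 0` gives
relevance. What remains is that `D_t` is independent of `s_k` exactly when no confounder acts on
both `s_k` and `a_t`, which is exogeneity; exclusion holds in every such graph.

Darmois–Skitovich is proved with characteristic functions: finite differences turn the functional
equation into a polynomial formula for logarithms of moduli, and `isGaussian_of_charFun_mul_eq_exp`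
(Marcinkiewicz and Cramér) concludes. -/

/-! ### Entire functions and polynomials. -/

/-- An entire function without zeros is the exponential of an entire function. -/
theorem exists_eq_cexp_of_entire {f : ℂ → ℂ} (hf : Differentiable ℂ f) (h0 : ∀ z, f z ≠ 0) :
    ∃ g : ℂ → ℂ, Differentiable ℂ g ∧ ∀ z, f z = Complex.exp (g z) := by
  have hd : Differentiable ℂ (deriv f) := hf.deriv
  -- `g` is a primitive of `f' / f`, so `f * exp (-g)` is constant; `c` absorbs the constant.
  obtain ⟨g, hg⟩ := (hd.div hf h0).isExactOn_univ
  have hg' : ∀ z, HasDerivAt g (deriv f z / f z) z := fun z => by simpa using hg z (Set.mem_univ z)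
  obtain ⟨c, hc⟩ : ∃ c, Complex.exp c = f 0 * Complex.exp (-g 0) :=
    ⟨Complex.log _, Complex.exp_log (mul_ne_zero (h0 0) (Complex.exp_ne_zero _))⟩
  refine ⟨fun z => g z + c, fun z => ((hg' z).add_const c).differentiableAt, fun z => ?_⟩
  have key : ∀ w, f w * Complex.exp (-g w) = f 0 * Complex.exp (-g 0) := by
    intro w
    have hder : ∀ z, HasDerivAt (fun z => f z * Complex.exp (-g z)) 0 z := fun z => by
      have h := (hf z).hasDerivAt.mul (hg' z).neg.cexp
      have e : deriv f z * Complex.exp (-g z) +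
          f z * (Complex.exp (-g z) * -(deriv f z / f z)) = 0 := by
        have := h0 z
        field_simp
        ring
      exact e ▸ h
    exact is_const_of_deriv_eq_zero (fun z => (hder z).differentiableAt)
      (fun z => (hder z).deriv) w 0
  rw [Complex.exp_add, hc, ← key z, Complex.exp_neg]
  field_simp [Complex.exp_ne_zero]

/-- An entire function whose real part has polynomial growth is a polynomial. -/
theorem exists_polynomial_of_entire_of_re_le {g : ℂ → ℂ} (hg : Differentiable ℂ g) {C : ℝ}
    (hC : 0 < C) (N : ℕ) (hb : ∀ z, (g z).re ≤ C * (1 + ‖z‖) ^ N) :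
    ∃ p : Polynomial ℂ, ∀ z, g z = p.eval z := by
  have hbound : ∀ r : ℝ, 1 ≤ r → ∀ z, ‖z‖ = r →
      ‖g z‖ ≤ (2 * C * 3 ^ N + 3 * ‖g 0‖) * r ^ N := by
    intro r hr z hz
    have hr0 : 0 < r := by linarith
    -- Borel–Carathéodory on the disc of radius `2 * r` turns the one-sided bound on the real part
    -- into a bound on the modulus.
    have h := Complex.borelCaratheodory (f := g) (M := C * (1 + 2 * r) ^ N) (R := 2 * r) (z := z)
      (by positivity) hg.differentiableOn
      (fun w hw => (hb w).trans (by
        have : ‖w‖ < 2 * r := by simpa using hw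
        show C * (1 + ‖w‖) ^ N ≤ _
        gcongr)) (by positivity) (by simp [hz]; linarith)
    rw [hz] at h
    have e1 : 2 * (C * (1 + 2 * r) ^ N) * r / (2 * r - r) = 2 * C * (1 + 2 * r) ^ N := by
      field_simp; ring
    have e2 : ‖g 0‖ * (2 * r + r) / (2 * r - r) = 3 * ‖g 0‖ := by
      field_simp; ring
    rw [e1, e2] at h
    refine h.trans ?_
    have h3 : (1 + 2 * r) ^ N ≤ (3 * r) ^ N := by gcongr; linarith
    have h1 : 1 ≤ r ^ N := one_le_pow₀ hr
    rw [mul_pow] at h3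
    have := mul_le_mul_of_nonneg_left h3 (by positivity : 0 ≤ 2 * C)
    nlinarith [norm_nonneg (g 0)]
  have hzero : ∀ n, N < n → iteratedDeriv n g 0 = 0 := by
    intro n hn
    set K := 2 * C * 3 ^ N + 3 * ‖g 0‖
    have hK : 0 < K := by positivity
    -- Cauchy's estimate gives `O(r ^ (N - n))`, which is at most `O(1 / r)` because `N < n`.
    have hle : ∀ r : ℝ, 1 ≤ r → ‖iteratedDeriv n g 0‖ ≤ (n.factorial * K) * r⁻¹ := by
      intro r hr
      have hr0 : 0 < r := by linarith
      refine (Complex.norm_iteratedDeriv_le_of_forall_mem_sphere_norm_le n hr0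
        hg.diffContOnCl (fun z hz => hbound r hr z (by simpa using hz))).trans ?_
      rw [mul_assoc, mul_div_assoc]
      gcongr
      rw [mul_div_assoc]
      gcongr
      rw [div_le_iff₀ (by positivity), inv_mul_eq_div, le_div_iff₀ hr0, ← pow_succ]
      exact pow_le_pow_right₀ hr hn
    have hlim : Filter.Tendsto (fun r : ℝ => (n.factorial * K) * r⁻¹) Filter.atTop
        (nhds (n.factorial * K * 0)) := tendsto_inv_atTop_zero.const_mul _
    rw [mul_zero] at hlim
    have := ge_of_tendsto hlim (Filter.eventually_atTop.2 ⟨1, hle⟩)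
    exact norm_le_zero_iff.1 this
  refine ⟨∑ n ∈ Finset.range (N + 1),
    Polynomial.monomial n ((n.factorial : ℂ)⁻¹ * iteratedDeriv n g 0), fun z => ?_⟩
  rw [← Complex.taylorSeries_eq_of_entire' 0 z hg, tsum_eq_sum (s := Finset.range (N + 1))]
  · simp [Polynomial.eval_finsetSum]
  · intro n hn
    rw [hzero n (by rw [Finset.mem_range] at hn; omega)]
    simp

theorem Polynomial.exists_norm_eval_le (p : Polynomial ℂ) :
    ∃ C : ℝ, 0 < C ∧ ∀ z, ‖p.eval z‖ ≤ C * (1 + ‖z‖) ^ p.natDegree := by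
  refine ⟨∑ i ∈ Finset.range (p.natDegree + 1), ‖p.coeff i‖ + 1, by positivity, fun z => ?_⟩
  rw [Polynomial.eval_eq_sum_range]
  refine (norm_sum_le _ _).trans ?_
  have h1 : 1 ≤ 1 + ‖z‖ := by linarith [norm_nonneg z]
  calc ∑ i ∈ Finset.range (p.natDegree + 1), ‖p.coeff i * z ^ i‖
      ≤ ∑ i ∈ Finset.range (p.natDegree + 1), ‖p.coeff i‖ * (1 + ‖z‖) ^ p.natDegree := by
        refine Finset.sum_le_sum fun i hi => ?_
        rw [norm_mul, norm_pow]
        gcongr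
        calc ‖z‖ ^ i ≤ (1 + ‖z‖) ^ i := by gcongr; linarith
          _ ≤ _ := pow_le_pow_right₀ h1 (by simpa [Nat.lt_succ_iff] using hi)
    _ ≤ _ := by
        rw [← Finset.sum_mul]
        gcongr
        linarith

/-- A polynomial whose exponential is a ridge function has degree at most two. -/
theorem Polynomial.natDegree_le_two_of_ridge (p : Polynomial ℂ)
    (h : ∀ z : ℂ, (p.eval z).re ≤ (p.eval (z.re : ℂ)).re) : p.natDegree ≤ 2 := by
  by_contra! hn
  set n := p.natDegree with hndef
  have hn0 : n ≠ 0 := by omega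
  set c := p.leadingCoeff with hcdef
  have hc : c ≠ 0 := by
    rw [hcdef, Ne, Polynomial.leadingCoeff_eq_zero]
    rintro rfl
    simp at hndef
    omega
  -- Rescaling along rays leaves only the leading term, which inherits the inequality.
  have hlim : ∀ w : ℂ, Filter.Tendsto (fun R : ℝ => p.eval ((R : ℂ) * w) / (R : ℂ) ^ n)
      Filter.atTop (nhds (c * w ^ n)) := by
    intro w
    have e : (fun R : ℝ => p.eval ((R : ℂ) * w) / (R : ℂ) ^ n) =ᶠ[Filter.atTop]
        fun R : ℝ => ∑ i ∈ Finset.range n, p.coeff i * w ^ i * (((R⁻¹ ^ (n - i) : ℝ)) : ℂ)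
          + c * w ^ n := by
      filter_upwards [Filter.eventually_gt_atTop (0 : ℝ)] with R hR
      have hR' : (R : ℂ) ≠ 0 := by exact_mod_cast hR.ne'
      rw [Polynomial.eval_eq_sum_range, Finset.sum_range_succ, add_div, Finset.sum_div]
      congr 1
      · refine Finset.sum_congr rfl fun i hi => ?_
        have hi' : i < n := by simpa using hi
        have : (R : ℂ) ^ n = (R : ℂ) ^ i * (R : ℂ) ^ (n - i) := by
          rw [← pow_add]; congr 1; omega
        push_cast
        rw [this, mul_pow, inv_pow]
        field_simp
      · rw [mul_pow, ← hndef, hcdef, Polynomial.leadingCoeff, ← hndef]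
        field_simp
    refine Filter.Tendsto.congr' e.symm ?_
    have : Filter.Tendsto (fun R : ℝ => ∑ i ∈ Finset.range n,
        p.coeff i * w ^ i * (((R⁻¹ ^ (n - i) : ℝ)) : ℂ) + c * w ^ n) Filter.atTop
        (nhds (∑ i ∈ Finset.range n, p.coeff i * w ^ i * ((0 : ℝ) : ℂ) + c * w ^ n)) := by
      refine Filter.Tendsto.add_const _ (tendsto_finsetSum _ fun i hi => ?_)
      have hi' : i < n := by simpa using hi
      refine Filter.Tendsto.const_mul _ ?_
      refine (Complex.continuous_ofReal.tendsto 0).comp ?_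
      have := (tendsto_inv_atTop_zero (𝕜 := ℝ)).pow (n - i)
      rwa [zero_pow (by omega)] at this
    simpa using this
  have hre : ∀ w : ℂ, (c * w ^ n).re ≤ (c * (w.re : ℂ) ^ n).re := by
    intro w
    refine le_of_tendsto_of_tendsto ((Complex.continuous_re.tendsto _).comp (hlim w))
      ((Complex.continuous_re.tendsto _).comp (hlim (w.re : ℂ))) ?_
    filter_upwards [Filter.eventually_gt_atTop (0 : ℝ)] with R hR
    have h1 := h ((R : ℂ) * w)
    have e1 : (((R : ℂ) * w).re : ℂ) = (R : ℂ) * (w.re : ℂ) := by simp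
    rw [e1] at h1
    simp only [Function.comp]
    rw [← Complex.ofReal_pow, Complex.div_ofReal_re, Complex.div_ofReal_re]
    gcongr
  have hreal : ∀ w : ℂ, ‖w‖ = 1 → c * w ^ n = (‖c‖ : ℂ) → w.im = 0 := by
    intro w hw hcw
    have h1 := hre w
    rw [hcw, Complex.ofReal_re] at h1
    have h2 := (h1.trans (Complex.re_le_norm _))
    rw [norm_mul, norm_pow, Complex.norm_real, Real.norm_eq_abs] at h2
    have hcpos : 0 < ‖c‖ := norm_pos_iff.2 hc
    have h3 : 1 ≤ |w.re| ^ n := by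
      by_contra! hlt
      nlinarith
    have h4 : 1 ≤ |w.re| := by
      by_contra! hlt
      exact absurd h3 (not_le.2 (pow_lt_one₀ (abs_nonneg _) hlt hn0))
    have h5 : w.re ^ 2 + w.im ^ 2 = 1 := by
      have := Complex.sq_norm w
      rw [hw, Complex.normSq_apply] at this
      linarith
    have h6 : 1 ≤ w.re ^ 2 := by rw [← sq_abs]; nlinarith
    have : w.im ^ 2 = 0 := le_antisymm (by linarith) (sq_nonneg _)
    exact pow_eq_zero_iff two_ne_zero |>.1 this
  -- `w` and `w * ζ` both maximise the real part of `c * w ^ n` on the unit circle, so both are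
  -- real. For `n ≥ 3` the root of unity `ζ` is not real, a contradiction.
  set w : ℂ := Complex.exp (((-Complex.arg c / n : ℝ) : ℂ) * Complex.I) with hwdef
  set ζ : ℂ := Complex.exp (((2 * Real.pi / n : ℝ) : ℂ) * Complex.I) with hζdef
  have hw1 : ‖w‖ = 1 := Complex.norm_exp_ofReal_mul_I _
  have hζ1 : ‖ζ‖ = 1 := Complex.norm_exp_ofReal_mul_I _
  have hnC : (n : ℂ) ≠ 0 := by exact_mod_cast hn0
  have hwn : c * w ^ n = (‖c‖ : ℂ) := by
    have h1 : w ^ n = Complex.exp (-(Complex.arg c * Complex.I)) := by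
      rw [hwdef, ← Complex.exp_nat_mul]
      congr 1
      push_cast
      field_simp
    rw [h1]
    nth_rewrite 1 [← Complex.norm_mul_exp_arg_mul_I c]
    rw [mul_assoc, ← Complex.exp_add, add_neg_cancel, Complex.exp_zero, mul_one]
  have hζn : ζ ^ n = 1 := by
    rw [hζdef, ← Complex.exp_nat_mul, ← Complex.exp_two_pi_mul_I]
    congr 1
    push_cast
    field_simp
  have him1 := hreal w hw1 hwn
  have him2 := hreal (w * ζ) (by rw [norm_mul, hw1, hζ1, one_mul])
    (by rw [mul_pow, hζn, mul_one, hwn])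
  have hζim : 0 < ζ.im := by
    rw [hζdef, Complex.exp_ofReal_mul_I_im]
    have hn3 : (3 : ℝ) ≤ n := by exact_mod_cast hn
    apply Real.sin_pos_of_pos_of_lt_pi
    · positivity
    · rw [div_lt_iff₀ (by linarith)]
      nlinarith [Real.pi_pos]
  rw [Complex.mul_im, him1] at him2
  have hwre : w.re = 0 := by
    rcases mul_eq_zero.1 (by simpa using him2 : w.re * ζ.im = 0) with h | h
    · exact h
    · exact absurd h hζim.ne'
  have : w = 0 := Complex.ext hwre him1
  rw [this] at hw1
  simp at hw1

/-! ### Moments from an entire extension of the characteristic function. -/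

section CharFunMoments
open Filter Topology

/-- If the characteristic function agrees near `0` with an entire function, then the second moment
is finite. -/
theorem integrable_sq_of_charFun_eq {ν : Measure ℝ} [IsFiniteMeasure ν] {F : ℂ → ℂ}
    (hF : Differentiable ℂ F) {δ : ℝ} (hδ : 0 < δ)
    (h : ∀ t : ℝ, |t| < δ → charFun ν t = F t) : Integrable (fun x => x ^ 2) ν := by
  set H : ℂ → ℂ := dslope (dslope F 0) 0 with hH
  have hd1 : Differentiable ℂ (dslope F 0) := by
    rw [← differentiableOn_univ] at hF ⊢
    exact (Complex.differentiableOn_dslope Filter.univ_mem).2 hF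
  have hd2 : Differentiable ℂ H := by
    rw [← differentiableOn_univ] at hd1 ⊢
    exact (Complex.differentiableOn_dslope Filter.univ_mem).2 hd1
  have hFH : ∀ z, F z = F 0 + z * (dslope F 0 0 + z * H z) := by
    intro z
    have h1 := sub_smul_dslope F 0 z
    have h2 := sub_smul_dslope (dslope F 0) 0 z
    simp only [sub_zero, smul_eq_mul] at h1 h2
    rw [h2]
    linear_combination -h1
  -- The integral of `q t` is the symmetric second difference quotient of the characteristic
  -- function at `0`, up to sign. It converges because `H` is continuous, and Fatou's lemma bounds
  -- the integral of the limit `x ^ 2`.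
  set q : ℝ → ℝ → ℝ := fun t x => (2 - 2 * Real.cos (t * x)) / t ^ 2 with hq
  have hq0 : ∀ t x, 0 ≤ q t x := fun t x => by
    have := Real.cos_le_one (t * x)
    exact div_nonneg (by linarith) (sq_nonneg _)
  have hqc : ∀ t, Continuous (q t) := fun t => by simp only [hq]; fun_prop
  have hqint : ∀ t, Integrable (q t) ν := fun t => by
    refine Integrable.div_const ?_ _
    refine Integrable.of_bound (C := 4) (by fun_prop) (ae_of_all _ fun x => ?_)
    rw [Real.norm_eq_abs, abs_le]
    constructor <;> linarith [Real.cos_le_one (t * x), Real.neg_one_le_cos (t * x)]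
  have hint : ∀ t : ℝ, t ≠ 0 → |t| < δ → ∫ x, q t x ∂ν = -(H t + H ((-t : ℝ) : ℂ)).re := by
    intro t ht htδ
    have hcos : ∫ x, Real.cos (t * x) ∂ν = (charFun ν t).re := by
      rw [charFun_apply_real]
      have : ∀ x : ℝ, Real.cos (t * x) = RCLike.re (Complex.exp (t * x * Complex.I)) := by
        intro x
        have := Complex.exp_ofReal_mul_I_re (t * x)
        push_cast at this
        exact this.symm
      simp_rw [this]
      rw [integral_re]
      · rfl
      · refine Integrable.of_bound (C := 1) (by fun_prop) (ae_of_all _ fun x => ?_)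
        have := Complex.norm_exp_ofReal_mul_I (t * x)
        push_cast at this
        exact this.le
    have h0 : ν.real Set.univ = (charFun ν 0).re := by simp
    have e1 : ∫ x, q t x ∂ν = (2 * (charFun ν 0).re - 2 * (charFun ν t).re) / t ^ 2 := by
      simp only [hq]
      rw [integral_div, integral_sub (integrable_const _), integral_const_mul, hcos, ← h0]
      · simp [mul_comm]
      · refine Integrable.of_bound (C := 2) (by fun_prop) (ae_of_all _ fun x => ?_)
        rw [Real.norm_eq_abs, abs_le]
        constructor <;> linarith [Real.cos_le_one (t * x), Real.neg_one_le_cos (t * x)]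
    have hsymm : (charFun ν (-t)).re = (charFun ν t).re := by
      rw [charFun_neg]; simp
    have e2 : 2 * (charFun ν 0).re - 2 * (charFun ν t).re
        = (2 * charFun ν 0 - charFun ν t - charFun ν (-t)).re := by
      simp only [Complex.sub_re, hsymm, Complex.mul_re]
      simp
      ring
    rw [e1, e2, h t htδ, h (-t) (by simpa using htδ), h 0 (by simpa using hδ), hFH t,
      hFH ((-t : ℝ) : ℂ)]
    have e3 : 2 * F ((0 : ℝ) : ℂ) - (F 0 + (t : ℂ) * (dslope F 0 0 + t * H t))
        - (F 0 + ((-t : ℝ) : ℂ) * (dslope F 0 0 + ((-t : ℝ) : ℂ) * H ((-t : ℝ) : ℂ)))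
        = ((t ^ 2 : ℝ) : ℂ) * (-(H t + H ((-t : ℝ) : ℂ))) := by
      push_cast
      ring
    rw [e3, Complex.re_ofReal_mul, Complex.neg_re]
    field_simp
  refine ⟨by fun_prop, ?_⟩
  rw [hasFiniteIntegral_iff_ofReal (ae_of_all _ fun x => sq_nonneg x)]
  have hlim : ∀ x : ℝ, Tendsto (fun t => q t x) (𝓝[≠] 0) (𝓝 (x ^ 2)) := by
    intro x
    have hs : Tendsto (fun t : ℝ => x * Real.sinc (t * x / 2)) (𝓝[≠] 0) (𝓝 (x * 1)) := by
      have : Continuous fun t : ℝ => x * Real.sinc (t * x / 2) := by fun_prop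
      have := (this.tendsto 0).mono_left (nhdsWithin_le_nhds (s := {0}ᶜ))
      simpa using this
    have := hs.pow 2
    rw [mul_one] at this
    refine this.congr' ?_
    filter_upwards [self_mem_nhdsWithin] with t ht
    have ht : t ≠ 0 := ht
    by_cases hx : x = 0
    · simp [hx, hq]
    · rw [Real.sinc_of_ne_zero (by positivity)]
      have hc : Real.cos (t * x) = 1 - 2 * Real.sin (t * x / 2) ^ 2 := by
        have := Real.cos_two_mul (t * x / 2)
        have h3 := Real.sin_sq_add_cos_sq (t * x / 2)
        rw [show 2 * (t * x / 2) = t * x by ring] at this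
        linarith
      simp only [hq, hc]
      field_simp
      ring
  have hlimH : Tendsto (fun t : ℝ => ∫⁻ x, ENNReal.ofReal (q t x) ∂ν) (𝓝[≠] 0)
      (𝓝 (ENNReal.ofReal (-(H ((0 : ℝ) : ℂ) + H ((-0 : ℝ) : ℂ)).re))) := by
    have hHc : Continuous H := hd2.continuous
    have hc : Continuous fun t : ℝ => -(H t + H ((-t : ℝ) : ℂ)).re := by fun_prop
    refine Tendsto.congr' ?_
      ((ENNReal.continuous_ofReal.comp hc).tendsto 0 |>.mono_left nhdsWithin_le_nhds)
    have : ∀ᶠ t : ℝ in 𝓝[≠] 0, |t| < δ := by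
      refine nhdsWithin_le_nhds ?_
      have := (continuous_abs.tendsto (0 : ℝ)).eventually_lt_const (u := δ) (by simpa using hδ)
      exact this
    filter_upwards [self_mem_nhdsWithin, this] with t ht htδ
    rw [Function.comp, ← hint t ht htδ,
      ofReal_integral_eq_lintegral_ofReal (hqint t) (ae_of_all _ (hq0 t))]
  calc ∫⁻ x, ENNReal.ofReal (x ^ 2) ∂ν
      = ∫⁻ x, liminf (fun t => ENNReal.ofReal (q t x)) (𝓝[≠] 0) ∂ν := by
        refine lintegral_congr fun x => ?_
        exact ((ENNReal.continuous_ofReal.tendsto _).comp (hlim x)).liminf_eq.symm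
    _ ≤ liminf (fun t => ∫⁻ x, ENNReal.ofReal (q t x) ∂ν) (𝓝[≠] 0) :=
        lintegral_liminf_le fun t => (hqc t).measurable.ennreal_ofReal
    _ = _ := hlimH.liminf_eq
    _ < ⊤ := ENNReal.ofReal_lt_top

theorem iteratedDeriv_two_comp_ofReal {F : ℂ → ℂ} (hF : Differentiable ℂ F) (t : ℝ) :
    iteratedDeriv 2 (fun s : ℝ => F s) t = iteratedDeriv 2 F t := by
  have h1 : deriv (fun s : ℝ => F s) = fun s : ℝ => deriv F s := by
    funext s
    exact (hF s).hasDerivAt.comp_ofReal.deriv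
  rw [iteratedDeriv_succ, iteratedDeriv_one, h1, iteratedDeriv_succ, iteratedDeriv_one]
  exact (hF.deriv t).hasDerivAt.comp_ofReal.deriv

/-- If the characteristic function agrees near `0` with an entire function, then the even moments
are the derivatives of that function at `0`. -/
theorem integrable_pow_of_charFun_eq (n : ℕ) {ν : Measure ℝ} [IsFiniteMeasure ν] {F : ℂ → ℂ}
    (hF : Differentiable ℂ F) {δ : ℝ} (hδ : 0 < δ)
    (h : ∀ t : ℝ, |t| < δ → charFun ν t = F t) :
    Integrable (fun x => x ^ (2 * n)) ν ∧
      ((∫ x, x ^ (2 * n) ∂ν : ℝ) : ℂ) = (-1) ^ n * iteratedDeriv (2 * n) F 0 := by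
  induction n generalizing ν F with
  | zero =>
    refine ⟨by simp, ?_⟩
    have := h 0 (by simpa using hδ)
    simp at this
    simp [this]
  | succ n ih =>
    have hsq := integrable_sq_of_charFun_eq hF hδ h
    set w : ℝ → NNReal := fun x => Real.toNNReal (x ^ 2) with hw
    have hwm : Measurable w := by fun_prop
    have hwc : ∀ x, ((w x : NNReal) : ℝ) = x ^ 2 := fun x => Real.coe_toNNReal _ (sq_nonneg x)
    -- Weighting by `x ^ 2` replaces `F` by `-F''`, again entire and with the same `δ`, so the
    -- induction hypothesis applies to `ν'`.
    set ν' := ν.withDensity (fun x => (w x : ENNReal)) with hν'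
    have : IsFiniteMeasure ν' := by
      refine isFiniteMeasure_withDensity_ofReal (f := fun x : ℝ => x ^ 2) hsq.2
    have hmem : MemLp id 2 ν := (memLp_two_iff_integrable_sq (by fun_prop)).2 hsq
    have hcf : ∀ t : ℝ, |t| < δ → charFun ν' t = -iteratedDeriv 2 F t := by
      intro t ht
      have e1 : iteratedDeriv 2 (charFun ν) t = iteratedDeriv 2 F t := by
        rw [← iteratedDeriv_two_comp_ofReal hF]
        refine Filter.EventuallyEq.iteratedDeriv_eq 2 ?_
        filter_upwards [continuous_abs.tendsto t |>.eventually_lt_const ht] with s hs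
        exact h s hs
      rw [← e1, iteratedDeriv_charFun hmem, charFun_apply_real, hν',
        integral_withDensity_eq_integral_smul hwm]
      simp only [Complex.I_sq, neg_mul, one_mul, neg_neg]
      refine integral_congr_ae (ae_of_all _ fun x => ?_)
      simp only [NNReal.smul_def, hwc]
      simp
    have hF' : Differentiable ℂ (fun z => -iteratedDeriv 2 F z) := by
      simp only [iteratedDeriv_succ]
      exact hF.deriv.deriv.neg
    obtain ⟨h1, h2⟩ := ih hF' hcf
    rw [hν', integrable_withDensity_iff_integrable_smul hwm] at h1
    rw [hν', integral_withDensity_eq_integral_smul hwm] at h2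
    have e : (fun x : ℝ => w x • x ^ (2 * n)) = fun x => x ^ (2 * (n + 1)) := by
      funext x
      rw [NNReal.smul_def, hwc, smul_eq_mul]
      ring
    rw [e] at h1 h2
    refine ⟨h1, ?_⟩
    rw [h2, iteratedDeriv_fun_neg, show 2 * (n + 1) = 2 * n + 2 by ring]
    have : iteratedDeriv (2 * n + 2) F 0 = iteratedDeriv (2 * n) (iteratedDeriv 2 F) 0 := by
      simp only [iteratedDeriv_eq_iterate, Function.iterate_add_apply]
    rw [this]
    ring

/-- If the characteristic function agrees near `0` with an entire function, then all exponential
moments are finite. -/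
theorem integrable_exp_of_charFun_eq {ν : Measure ℝ} [IsFiniteMeasure ν] {F : ℂ → ℂ}
    (hF : Differentiable ℂ F) {δ : ℝ} (hδ : 0 < δ)
    (h : ∀ t : ℝ, |t| < δ → charFun ν t = F t) (s : ℝ) :
    Integrable (fun x => Real.exp (s * x)) ν := by
  -- Even moments are Taylor coefficients of `F` up to sign and factorials, so absolute convergence
  -- of the Taylor series makes `cosh (s * x)` integrable.
  have hsum : Summable fun n : ℕ => s ^ (2 * n) / (2 * n).factorial * ∫ x, x ^ (2 * n) ∂ν := by
    have h1 := (Complex.hasSum_taylorSeries_of_entire hF 0 (s : ℂ)).summable.norm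
    have h2 := h1.comp_injective (i := fun n : ℕ => 2 * n) (fun a b hab => by simpa using hab)
    refine Summable.of_norm_bounded h2 fun n => ?_
    have h3 := congrArg norm (integrable_pow_of_charFun_eq n hF hδ h).2
    rw [Complex.norm_real] at h3
    simp only [Function.comp, norm_mul, norm_smul, norm_div, h3]
    simp
    ring_nf
    rfl
  have hcosh : Integrable (fun x => Real.cosh (s * x)) ν := by
    refine ⟨by fun_prop, ?_⟩
    rw [hasFiniteIntegral_iff_ofReal (ae_of_all _ fun x => (Real.cosh_pos _).le)]
    have hterm : ∀ n : ℕ, ∀ x : ℝ, 0 ≤ (s * x) ^ (2 * n) / (2 * n).factorial := fun n x =>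
      div_nonneg (by rw [pow_mul]; positivity) (by positivity)
    have e : ∀ x : ℝ, ENNReal.ofReal (Real.cosh (s * x))
        = ∑' n : ℕ, ENNReal.ofReal ((s * x) ^ (2 * n) / (2 * n).factorial) := by
      intro x
      rw [Real.cosh_eq_tsum, ENNReal.ofReal_tsum_of_nonneg (fun n => hterm n x)
        (Real.hasSum_cosh _).summable]
    simp_rw [e]
    rw [lintegral_tsum (fun n => by fun_prop)]
    have e2 : ∀ n : ℕ, ∫⁻ x, ENNReal.ofReal ((s * x) ^ (2 * n) / (2 * n).factorial) ∂ν
        = ENNReal.ofReal (s ^ (2 * n) / (2 * n).factorial * ∫ x, x ^ (2 * n) ∂ν) := by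
      intro n
      have e3 : (fun x : ℝ => (s * x) ^ (2 * n) / (2 * n).factorial)
          = fun x => s ^ (2 * n) / (2 * n).factorial * x ^ (2 * n) := by
        funext x; rw [mul_pow]; ring
      rw [← integral_const_mul, ← e3, ofReal_integral_eq_lintegral_ofReal]
      · rw [e3]; exact (integrable_pow_of_charFun_eq n hF hδ h).1.const_mul _
      · exact ae_of_all _ (hterm n)
    simp_rw [e2]
    exact hsum.tsum_ofReal_lt_top
  refine (hcosh.const_mul 2).mono' (by fun_prop) (ae_of_all _ fun x => ?_)
  rw [Real.norm_eq_abs, abs_of_pos (Real.exp_pos _), Real.cosh_eq]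
  linarith [Real.exp_pos (-(s * x))]

end CharFunMoments

/-! ### The theorems of Marcinkiewicz and Cramér. -/

section CramerMarcinkiewicz
open Filter Topology

theorem integrableExpSet_eq_univ {ν : Measure ℝ}
    (h : ∀ s : ℝ, Integrable (fun x => Real.exp (s * x)) ν) : integrableExpSet id ν = Set.univ :=
  Set.eq_univ_of_forall h

theorem differentiable_complexMGF {ν : Measure ℝ}
    (h : ∀ s : ℝ, Integrable (fun x => Real.exp (s * x)) ν) :
    Differentiable ℂ (complexMGF id ν) := fun z => by
  refine (hasDerivAt_complexMGF ?_).differentiableAt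
  simp [integrableExpSet_eq_univ h]

/-- Two entire functions that agree near `0` on the imaginary axis are equal. -/
theorem eq_of_eq_on_imaginary_axis {f g : ℂ → ℂ} (hf : Differentiable ℂ f)
    (hg : Differentiable ℂ g) {δ : ℝ} (hδ : 0 < δ)
    (h : ∀ t : ℝ, |t| < δ → f (t * Complex.I) = g (t * Complex.I)) : f = g := by
  refine AnalyticOnNhd.eq_of_frequently_eq (𝕜 := ℂ) (z₀ := 0)
    (fun z _ => hf.analyticAt z) (fun z _ => hg.analyticAt z) ?_
  have ht : Tendsto (fun t : ℝ => (t : ℂ) * Complex.I) (𝓝[≠] 0) (𝓝[≠] 0) := by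
    refine tendsto_nhdsWithin_iff.2 ⟨?_, ?_⟩
    · have : Continuous fun t : ℝ => (t : ℂ) * Complex.I := by fun_prop
      simpa using (this.tendsto 0).mono_left nhdsWithin_le_nhds
    · filter_upwards [self_mem_nhdsWithin] with t ht
      simpa using ht
  refine ht.frequently (Eventually.frequently ?_)
  refine nhdsWithin_le_nhds ?_
  filter_upwards [(continuous_abs.tendsto (0 : ℝ)).eventually_lt_const (u := δ) (by simpa using hδ)]
    with t ht
  exact h t ht

/-- The exponential of a sum factors, so an integrable slice given by Fubini is a nonzero multiple
of the exponential of one variable. -/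
theorem integrable_exp_of_conv {ν₁ ν₂ : Measure ℝ} [IsProbabilityMeasure ν₁]
    [IsProbabilityMeasure ν₂] {s : ℝ}
    (h : Integrable (fun x => Real.exp (s * x)) (ν₁.conv ν₂)) :
    Integrable (fun x => Real.exp (s * x)) ν₁ ∧ Integrable (fun x => Real.exp (s * x)) ν₂ := by
  rw [Measure.conv, integrable_map_measure (by fun_prop) (by fun_prop)] at h
  have e : ((fun x => Real.exp (s * x)) ∘ fun p : ℝ × ℝ => p.1 + p.2)
      = fun p => Real.exp (s * p.1) * Real.exp (s * p.2) := by
    funext p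
    simp [mul_add, Real.exp_add]
  rw [e] at h
  obtain ⟨x, hx⟩ := h.prod_right_ae.exists
  obtain ⟨y, hy⟩ := h.prod_left_ae.exists
  constructor
  · simpa [mul_assoc] using hy.mul_const (Real.exp (s * y))⁻¹
  · have := hx.const_mul (Real.exp (s * x))⁻¹
    simpa [← mul_assoc] using this

/-- Jensen's inequality, from the tangent to the exponential at the mean. It is needed to divide by
the second factor in the proof of Cramér's theorem. -/
theorem exp_mean_le_mgf {ν : Measure ℝ} [IsProbabilityMeasure ν]
    (h : ∀ s : ℝ, Integrable (fun x => Real.exp (s * x)) ν) (s : ℝ) :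
    Real.exp (s * ∫ x, x ∂ν) ≤ mgf id ν s := by
  have hid : Integrable (fun x : ℝ => x) ν := by
    have := integrable_pow_of_mem_interior_integrableExpSet (X := id) (μ := ν)
      (by simp [integrableExpSet_eq_univ h]) 1
    simpa using this
  set m := ∫ x, x ∂ν
  have h1 : ∫ x, (Real.exp (s * m) * (s * (x - m) + 1)) ∂ν ≤ mgf id ν s := by
    refine integral_mono ?_ (h s) fun x => ?_
    · exact (((hid.sub (integrable_const m)).const_mul s).add (integrable_const 1)).const_mul _
    · have := Real.add_one_le_exp (s * (x - m))
      calc Real.exp (s * m) * (s * (x - m) + 1) ≤ Real.exp (s * m) * Real.exp (s * (x - m)) := by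
            gcongr
        _ = Real.exp (s * id x) := by rw [← Real.exp_add]; simp; ring
  have h2 : ∫ x, (Real.exp (s * m) * (s * (x - m) + 1)) ∂ν = Real.exp (s * m) := by
    have hsub : Integrable (fun x : ℝ => x - m) ν := hid.sub (integrable_const m)
    rw [integral_const_mul, integral_add (hsub.const_mul s)
      (integrable_const 1), integral_const_mul, integral_sub hid (integrable_const m)]
    simp [m]
  rwa [h2] at h1

/-- **Marcinkiewicz' theorem and Cramér's decomposition theorem.** If the product of two
characteristic functions agrees near `0` with the exponential of a polynomial, then both factors
are Gaussian. -/
theorem isGaussian_of_charFun_mul_eq_exp {ν₁ ν₂ : Measure ℝ} [IsProbabilityMeasure ν₁]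
    [IsProbabilityMeasure ν₂] (p : Polynomial ℂ) {δ : ℝ} (hδ : 0 < δ)
    (h : ∀ t : ℝ, |t| < δ → charFun ν₁ t * charFun ν₂ t = Complex.exp (p.eval (t : ℂ))) :
    IsGaussian ν₁ := by
  have hF : Differentiable ℂ fun z => Complex.exp (p.eval z) := p.differentiable.cexp
  have hexp : ∀ s : ℝ, Integrable (fun x => Real.exp (s * x)) (ν₁.conv ν₂) := fun s =>
    integrable_exp_of_charFun_eq hF hδ (fun t ht => by rw [charFun_conv, h t ht]) s
  have hexp₁ := fun s => (integrable_exp_of_conv (hexp s)).1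
  have hexp₂ := fun s => (integrable_exp_of_conv (hexp s)).2
  set f₁ := complexMGF id ν₁ with hf₁
  set f₂ := complexMGF id ν₂ with hf₂
  have hd₁ : Differentiable ℂ f₁ := differentiable_complexMGF hexp₁
  have hd₂ : Differentiable ℂ f₂ := differentiable_complexMGF hexp₂
  -- By analytic continuation the product formula holds everywhere, so `f₁` has no zeros and has an
  -- entire logarithm `g`.
  have hprod : ∀ z, f₁ z * f₂ z = Complex.exp (p.eval (-Complex.I * z)) := by
    refine fun z => congrFun (eq_of_eq_on_imaginary_axis (f := fun z => f₁ z * f₂ z)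
      (g := fun z => Complex.exp (p.eval (-Complex.I * z))) (hd₁.mul hd₂) ?_ hδ fun t ht => ?_) z
    · exact hF.comp (differentiable_id.const_mul (-Complex.I))
    · simp only [hf₁, hf₂, complexMGF_id_mul_I]
      rw [h t ht]
      congr 2
      linear_combination (t : ℂ) * Complex.I_sq
  obtain ⟨g, hg, hfg⟩ := exists_eq_cexp_of_entire hd₁ fun z hz => by
    have := hprod z
    rw [hz, zero_mul] at this
    exact Complex.exp_ne_zero _ this.symm
  have hre : ∀ z, Real.exp (g z).re = ‖f₁ z‖ := fun z => by rw [hfg, Complex.norm_exp]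
  have hridge : ∀ z, (g z).re ≤ (g (z.re : ℂ)).re := by
    intro z
    rw [← Real.exp_le_exp, hre, hre, hf₁, complexMGF_ofReal, Complex.norm_real]
    exact norm_complexMGF_le_mgf.trans (le_abs_self _)
  have hmgf : ∀ x : ℝ, mgf id ν₁ x = Real.exp (g x).re := by
    intro x
    rw [hre, hf₁, complexMGF_ofReal, Complex.norm_real, Real.norm_eq_abs, abs_of_nonneg mgf_nonneg]
  obtain ⟨C, hC, hCb⟩ := p.exists_norm_eval_le
  set m := ∫ x, x ∂ν₂
  -- The ridge property reduces the bound to real `x`; there the product formula and the lower bound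
  -- `exp (x * m)` for the second factor control the first.
  have hgrow : ∀ z, (g z).re ≤ (C + |m|) * (1 + ‖z‖) ^ (p.natDegree + 1) := by
    intro z
    refine (hridge z).trans ?_
    set x := z.re
    have hxz : |x| ≤ ‖z‖ := Complex.abs_re_le_norm z
    have h1 : Real.exp (g x).re * Real.exp (x * m) ≤ Real.exp ‖p.eval (-Complex.I * x)‖ := by
      calc Real.exp (g x).re * Real.exp (x * m) ≤ mgf id ν₁ x * mgf id ν₂ x := by
            rw [hmgf]
            gcongr
            exact exp_mean_le_mgf hexp₂ x
        _ = ‖f₁ x * f₂ x‖ := by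
            rw [hf₁, hf₂, complexMGF_ofReal, complexMGF_ofReal, norm_mul, Complex.norm_real,
              Complex.norm_real, Real.norm_eq_abs, Real.norm_eq_abs, abs_of_nonneg mgf_nonneg,
              abs_of_nonneg mgf_nonneg]
        _ ≤ _ := by
            rw [hprod, Complex.norm_exp]
            exact Real.exp_le_exp.2 (Complex.re_le_norm _)
    rw [← Real.exp_add, Real.exp_le_exp] at h1
    have h2 := hCb (-Complex.I * x)
    have h3 : ‖-Complex.I * (x : ℂ)‖ = |x| := by simp
    rw [h3] at h2
    have h4 : -(x * m) ≤ |m| * ‖z‖ := by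
      calc -(x * m) ≤ |x * m| := neg_le_abs _
        _ = |m| * |x| := by rw [abs_mul, mul_comm]
        _ ≤ _ := by gcongr
    have h1z : 1 ≤ 1 + ‖z‖ := by linarith [norm_nonneg z]
    have h5 : C * (1 + |x|) ^ p.natDegree ≤ C * (1 + ‖z‖) ^ (p.natDegree + 1) := by
      refine mul_le_mul_of_nonneg_left ?_ hC.le
      calc (1 + |x|) ^ p.natDegree ≤ (1 + ‖z‖) ^ p.natDegree := by gcongr
        _ ≤ _ := pow_le_pow_right₀ h1z (Nat.le_succ _)
    have h6 : |m| * ‖z‖ ≤ |m| * (1 + ‖z‖) ^ (p.natDegree + 1) := by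
      gcongr
      calc ‖z‖ ≤ (1 + ‖z‖) ^ 1 := by linarith
        _ ≤ _ := pow_le_pow_right₀ h1z (by omega)
    linarith
  obtain ⟨q, hq⟩ := exists_polynomial_of_entire_of_re_le hg (by positivity) _ hgrow
  have hdeg : q.natDegree ≤ 2 := q.natDegree_le_two_of_ridge fun z => by
    rw [← hq, ← hq]; exact hridge z
  have hgre : ∀ x : ℝ, (g x).re = (q.coeff 0).re + (q.coeff 1).re * x + (q.coeff 2).re * x ^ 2 := by
    intro x
    rw [hq, Polynomial.eval_eq_sum_range' (n := 3) (by omega)]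
    simp [Finset.sum_range_succ, Complex.add_re, Complex.mul_re, ← Complex.ofReal_pow]
  set b := (q.coeff 1).re
  set c := (q.coeff 2).re
  have h0 : (q.coeff 0).re = 0 := by
    have := hmgf 0
    have h1 := hgre 0
    rw [mgf_zero, eq_comm, Real.exp_eq_one_iff, h1] at this
    simpa using this
  have hmgf' : ∀ x : ℝ, mgf id ν₁ x = Real.exp (b * x + c * x ^ 2) := by
    intro x
    rw [hmgf, hgre, h0, zero_add]
  -- Jensen at `1` and `-1`: the linear terms cancel in the sum.
  have hc : 0 ≤ c := by
    have key : ∀ x : ℝ, x * ∫ y, y ∂ν₁ ≤ b * x + c * x ^ 2 := by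
      intro x
      rw [← Real.exp_le_exp, ← hmgf']
      exact exp_mean_le_mgf hexp₁ x
    have k1 := key 1
    have k2 := key (-1)
    linarith
  have hgauss : ν₁ = gaussianReal b (2 * c).toNNReal := by
    refine Measure.ext_of_complexMGF_id_eq ?_
    have heq : mgf id ν₁ = mgf id (gaussianReal b (2 * c).toNNReal) := by
      rw [mgf_id_gaussianReal]
      funext x
      rw [hmgf', Real.coe_toNNReal _ (by positivity)]
      congr 1
      ring
    funext z
    exact eqOn_complexMGF_of_mgf heq (by simp [integrableExpSet_eq_univ hexp₁])
  rw [hgauss]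
  infer_instance

end CramerMarcinkiewicz

/-! ### Functional equations solved by finite differences. -/

section FiniteDifferences

/-- `f` agrees on `(-δ, δ)` with a polynomial of degree less than `n`. -/
def IsPolynomialNear (δ : ℝ) (n : ℕ) (f : ℝ → ℝ) : Prop :=
  ∃ p : Polynomial ℝ, p.degree < n ∧ ∀ t, |t| < δ → f t = p.eval t

theorem IsPolynomialNear.mono {δ δ' : ℝ} {n : ℕ} {f : ℝ → ℝ} (h : IsPolynomialNear δ n f)
    (hδ : δ' ≤ δ) : IsPolynomialNear δ' n f := by
  obtain ⟨p, hp, hf⟩ := h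
  exact ⟨p, hp, fun t ht => hf t (ht.trans_le hδ)⟩

theorem Polynomial.exists_derivative_eq {n : ℕ} {p : Polynomial ℝ} (hp : p.degree < n) :
    ∃ P : Polynomial ℝ, P.degree < (n + 1 : ℕ) ∧ P.derivative = p := by
  refine ⟨∑ i ∈ Finset.range n, Polynomial.monomial (i + 1) (p.coeff i / (i + 1)), ?_, ?_⟩
  · rw [← Polynomial.mem_degreeLT]
    refine Submodule.sum_mem _ fun i hi => ?_
    rw [Polynomial.mem_degreeLT]
    refine (Polynomial.degree_monomial_le _ _).trans_lt ?_
    have : i < n := by simpa using hi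
    exact_mod_cast Nat.succ_lt_succ this
  · ext k
    rw [Polynomial.coeff_derivative, Polynomial.finsetSum_coeff]
    simp only [Polynomial.coeff_monomial, Nat.add_right_cancel_iff]
    rw [Finset.sum_ite_eq' (Finset.range n) k]
    by_cases hk : k < n
    · have : (k : ℝ) + 1 ≠ 0 := by positivity
      simp [hk]
      field_simp
    · simp only [Finset.mem_range, hk, if_false, zero_mul]
      rw [Polynomial.coeff_eq_zero_of_degree_lt]
      exact hp.trans_le (by exact_mod_cast not_lt.1 hk)

/-- A continuous function whose small increments are polynomials of bounded degree is a
polynomial. -/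
theorem isPolynomialNear_succ_of_increments {f : ℝ → ℝ} (hf : Continuous f) {δ : ℝ} (hδ : 0 < δ)
    {n : ℕ} (h : ∀ η, |η| < δ → IsPolynomialNear δ n fun t => f (t + η) - f t) :
    IsPolynomialNear δ (n + 1) f := by
  -- Interpolating at `n` fixed nodes makes the dependence of the increments on `η` explicit, so
  -- that they can be integrated over `η`.
  set v : ℕ → ℝ := fun i => δ * (i / (n + 1)) with hv
  set s := Finset.range n with hs
  have hvinj : Set.InjOn v s := by
    intro i _ j _ hij
    have h1 : (i : ℝ) / (n + 1) = j / (n + 1) := mul_left_cancel₀ hδ.ne' hij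
    have h2 : (n : ℝ) + 1 ≠ 0 := by positivity
    field_simp at h1
    exact_mod_cast h1
  have hvδ : ∀ i ∈ s, |v i| < δ := by
    intro i hi
    have hi' : (i : ℝ) < n := by exact_mod_cast Finset.mem_range.1 hi
    rw [abs_of_nonneg (by positivity)]
    simp only [hv]
    have : (i : ℝ) / (n + 1) < 1 := by
      rw [div_lt_one (by positivity)]; linarith
    nlinarith
  have hinterp : ∀ η, |η| < δ → ∀ t, |t| < δ → f (t + η) - f t
      = ∑ i ∈ s, (f (v i + η) - f (v i)) * (Lagrange.basis s v i).eval t := by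
    intro η hη t ht
    obtain ⟨p, hp, hpe⟩ := h η hη
    beta_reduce at hpe
    have h1 := Lagrange.eq_interpolate hvinj (f := p) (by simpa [hs] using hp)
    rw [hpe t ht, h1, Lagrange.interpolate_apply, Polynomial.eval_finsetSum]
    refine Finset.sum_congr rfl fun i hi => ?_
    rw [Polynomial.eval_mul, Polynomial.eval_C, ← hpe _ (hvδ i hi)]
  set ε := δ / 2 with hε
  have hε0 : 0 < ε := by positivity
  set Q : Polynomial ℝ := ∑ i ∈ s,
    Polynomial.C (∫ η in (0 : ℝ)..ε, (f (v i + η) - f (v i))) * Lagrange.basis s v i with hQ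
  have hQdeg : Q.degree < n := by
    have := Lagrange.degree_interpolate_lt
      (fun i => ∫ η in (0 : ℝ)..ε, (f (v i + η) - f (v i))) hvinj
    rw [Lagrange.interpolate_apply] at this
    simpa [hs] using this
  set Φ : ℝ → ℝ := fun x => ∫ y in (0 : ℝ)..x, f y with hΦ
  have hΦd : ∀ x, HasDerivAt Φ (f x) x := fun x =>
    intervalIntegral.integral_hasDerivAt_right (hf.intervalIntegrable _ _)
      (hf.stronglyMeasurableAtFilter _ _) hf.continuousAt
  -- Averaging over `η ∈ [0, ε]` expresses `f` by its primitive `Φ`. Hence `f` is differentiable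
  -- near `0`, with a derivative built from an increment of `f` and `Q'`, a polynomial of degree
  -- less than `n`.
  have hmain : ∀ t, |t| < δ → f t = ε⁻¹ * (Φ (t + ε) - Φ t - Q.eval t) := by
    intro t ht
    have e1 : ∫ η in (0 : ℝ)..ε, (f (t + η) - f t) = Q.eval t := by
      rw [hQ, Polynomial.eval_finsetSum]
      simp only [Polynomial.eval_mul, Polynomial.eval_C]
      simp_rw [← intervalIntegral.integral_mul_const]
      rw [← intervalIntegral.integral_finsetSum]
      · refine intervalIntegral.integral_congr fun η hη => ?_
        rw [Set.uIcc_of_le hε0.le] at hη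
        exact hinterp η (by rw [abs_of_nonneg hη.1]; linarith [hη.2]) t ht
      · intro i _
        exact Continuous.intervalIntegrable (by fun_prop) _ _
    have e2 : ∫ η in (0 : ℝ)..ε, (f (t + η) - f t) = Φ (t + ε) - Φ t - ε * f t := by
      rw [intervalIntegral.integral_sub (Continuous.intervalIntegrable (by fun_prop) _ _)
        (Continuous.intervalIntegrable (by fun_prop) _ _),
        intervalIntegral.integral_comp_add_left (fun y => f y) t,
        intervalIntegral.integral_const, add_zero, hΦ]
      simp only
      rw [intervalIntegral.integral_interval_sub_left (hf.intervalIntegrable _ _)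
        (hf.intervalIntegrable _ _)]
      simp
    rw [← e1, e2]
    field_simp
    ring
  obtain ⟨r, hr, hre⟩ := h ε (by rw [abs_of_pos hε0]; linarith)
  beta_reduce at hre
  set w : Polynomial ℝ := Polynomial.C ε⁻¹ * (r - Q.derivative) with hw
  have hwdeg : w.degree < n := by
    rw [hw, Polynomial.degree_C_mul (inv_ne_zero hε0.ne')]
    refine (Polynomial.degree_sub_le _ _).trans_lt (max_lt hr ?_)
    exact (Polynomial.degree_derivative_le).trans_lt hQdeg
  have hfd : ∀ t, |t| < δ → HasDerivAt f (w.eval t) t := by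
    intro t ht
    have h1 : HasDerivAt (fun t => ε⁻¹ * (Φ (t + ε) - Φ t - Q.eval t))
        (ε⁻¹ * (f (t + ε) - f t - Q.derivative.eval t)) t :=
      ((((hΦd (t + ε)).comp_add_const t ε).sub (hΦd t)).sub (Q.hasDerivAt t)).const_mul _
    have e : w.eval t = ε⁻¹ * (f (t + ε) - f t - Q.derivative.eval t) := by
      rw [hre t ht, hw]
      simp
    rw [e]
    refine h1.congr_of_eventuallyEq ?_
    filter_upwards [(continuous_abs.tendsto t).eventually_lt_const ht] with x hx
    exact hmain x hx
  obtain ⟨P, hPdeg, hP⟩ := Polynomial.exists_derivative_eq hwdeg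
  refine ⟨P + Polynomial.C (f 0 - P.eval 0), ?_, fun t ht => ?_⟩
  · refine (Polynomial.degree_add_le _ _).trans_lt (max_lt hPdeg ?_)
    exact Polynomial.degree_C_le.trans_lt (by exact_mod_cast Nat.succ_pos n)
  · have hconst : f t - P.eval t = f 0 - P.eval 0 := by
      have hder : ∀ x, |x| < δ → HasDerivAt (fun x => f x - P.eval x) 0 x := fun x hx => by
        have := (hfd x hx).sub (P.hasDerivAt x)
        rwa [hP, sub_self] at this
      refine IsOpen.is_const_of_deriv_eq_zero (f := fun x => f x - P.eval x)
        (s := Set.Ioo (-δ) δ) isOpen_Ioo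
        isPreconnected_Ioo (fun x hx => ?_) (fun x hx => ?_) (abs_lt.1 ht)
        (show (0 : ℝ) ∈ Set.Ioo (-δ) δ from ⟨by linarith, hδ⟩)
      · exact (hder x (abs_lt.2 hx)).differentiableAt.differentiableWithinAt
      · exact (hder x (abs_lt.2 hx)).deriv
    simp only [Polynomial.eval_add, Polynomial.eval_C]
    linarith

/-- If `F₀ (x + r₀ y) + ∑ r ∈ T, F r (x + r y) + B y` vanishes near the origin and `r₀ ∉ T`, then
`F₀` is a polynomial near `0`. -/
theorem exists_isPolynomialNear_of_sum_eq_zero (T : Finset ℝ) (r₀ : ℝ) (hr₀ : r₀ ∉ T) :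
    ∃ n : ℕ, ∀ δ > 0, ∃ δ' > 0, ∀ (F₀ : ℝ → ℝ) (F : ℝ → ℝ → ℝ) (B : ℝ → ℝ), Continuous F₀ →
      (∀ x y, |x| < δ → |y| < δ → F₀ (x + r₀ * y) + ∑ r ∈ T, F r (x + r * y) + B y = 0) →
      IsPolynomialNear δ' n F₀ := by
  induction T using Finset.induction_on with
  | empty =>
    refine ⟨1, fun δ hδ => ⟨δ, hδ, fun F₀ F B _ h => ?_⟩⟩
    refine ⟨Polynomial.C (-B 0), Polynomial.degree_C_le.trans_lt (by norm_num), fun t ht => ?_⟩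
    have := h t 0 ht (by simpa using hδ)
    simp at this
    simp
    linarith
  | insert r₁ T hr₁ ih =>
    rw [Finset.mem_insert, not_or] at hr₀
    obtain ⟨n, hn⟩ := ih hr₀.2
    have hne : r₀ - r₁ ≠ 0 := sub_ne_zero.2 hr₀.1
    refine ⟨n + 1, fun δ hδ => ?_⟩
    -- The degree bound and `δ₁` do not depend on the functions, so they serve all increments at
    -- once. The other half of `δ` leaves room for the shift.
    obtain ⟨δ₁, hδ₁, hδ₁'⟩ := hn (δ / 2) (by positivity)
    set η₀ := |r₀ - r₁| * ((δ / 2) / (1 + |r₁|)) with hη₀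
    have hη₀pos : 0 < η₀ := by positivity
    refine ⟨min δ₁ η₀, lt_min hδ₁ hη₀pos, fun F₀ F B hF₀ h => ?_⟩
    refine isPolynomialNear_succ_of_increments hF₀ (lt_min hδ₁ hη₀pos) fun η hη => ?_
    have hη2 : |η| < η₀ := hη.trans_le (min_le_right _ _)
    -- The shift of `(x, y)` by `(-r₁ * k, k)` fixes `x + r₁ * y` and moves `x + r₀ * y` by `η`;
    -- subtracting the two equations removes `F r₁`.
    set k := η / (r₀ - r₁) with hk
    have hkη : (r₀ - r₁) * k = η := by rw [hk]; field_simp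
    have hk1 : |k| * (1 + |r₁|) < δ / 2 := by
      rw [hk, abs_div, div_mul_eq_mul_div, div_lt_iff₀ (abs_pos.2 hne)]
      have : η₀ * (1 + |r₁|) = δ / 2 * |r₀ - r₁| := by
        rw [hη₀]; field_simp
      rw [← this]
      gcongr
    have hk2 : |k| < δ / 2 := by nlinarith [abs_nonneg k, abs_nonneg r₁]
    have hk3 : |r₁ * k| < δ / 2 := by rw [abs_mul]; nlinarith [abs_nonneg k, abs_nonneg r₁]
    refine (hδ₁' _ (fun r z => F r (z + (r - r₁) * k) - F r z) (fun y => B (y + k) - B y)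
      (by fun_prop) fun x y hx hy => ?_).mono (min_le_left _ _)
    have h1 := h x y (by linarith) (by linarith)
    have h2 := h (x - r₁ * k) (y + k) (by have := abs_sub x (r₁ * k); linarith)
      (by have := abs_add_le y k; linarith)
    rw [Finset.sum_insert hr₁] at h1 h2
    have e0 : x - r₁ * k + r₀ * (y + k) = x + r₀ * y + η := by rw [← hkη]; ring
    have e1 : x - r₁ * k + r₁ * (y + k) = x + r₁ * y := by ring
    have e2 : ∀ r, x - r₁ * k + r * (y + k) = x + r * y + (r - r₁) * k := fun r => by ring
    rw [e0, e1] at h2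
    simp only [e2] at h2
    rw [Finset.sum_sub_distrib]
    linarith

end FiniteDifferences

/-! ### The Darmois–Skitovich theorem. -/

section DarmoisSkitovich
open Filter Topology

variable {ι : Type*}

/-- For functions that satisfy the functional equation of independent linear forms, the logarithms
of the moduli along one ratio of coefficients sum up to a polynomial near `0`. -/
theorem exists_polynomial_sum_log_norm (s : Finset ι) (φ : ι → ℝ → ℂ)
    (hφc : ∀ i, Continuous (φ i)) (hφ0 : ∀ i, φ i 0 = 1) (a b : ι → ℝ)
    (h : ∀ x y, ∏ i ∈ s, φ i (a i * x + b i * y)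
      = (∏ i ∈ s, φ i (a i * x)) * ∏ i ∈ s, φ i (b i * y))
    {r₀ : ℝ} (hr₀ : r₀ ≠ 0) :
    ∃ p : Polynomial ℝ, ∃ δ > 0, ∀ t, |t| < δ →
      ∏ i ∈ s with a i ≠ 0 ∧ b i / a i = r₀, ‖φ i (a i * t)‖ = Real.exp (p.eval t) := by
  classical
  have hev : ∀ᶠ t : ℝ in 𝓝 0, ∀ i ∈ s, 1 / 2 < ‖φ i t‖ := by
    rw [Filter.eventually_all_finset]
    intro i _
    have := ((hφc i).norm.tendsto 0).eventually_const_lt (u := 1 / 2)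
      (by rw [hφ0, norm_one]; norm_num)
    exact this
  obtain ⟨δ₀, hδ₀, hδ₀'⟩ := Metric.eventually_nhds_iff.1 hev
  set S := ∑ i ∈ s, (|a i| + |b i|) with hS
  have hS0 : 0 ≤ S := by positivity
  set δ := δ₀ / (1 + S) with hδ
  have hδpos : 0 < δ := by positivity
  have hSδ : (1 + S) * δ = δ₀ := by rw [hδ]; field_simp
  have hsmall : ∀ i ∈ s, ∀ x y, |x| < δ → |y| < δ → 1 / 2 < ‖φ i (a i * x + b i * y)‖ := by
    intro i hi x y hx hy
    refine hδ₀' ?_ i hi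
    rw [Real.dist_eq, sub_zero]
    have h1 : |a i| + |b i| ≤ S :=
      Finset.single_le_sum (f := fun i => |a i| + |b i|) (fun i _ => by positivity) hi
    calc |a i * x + b i * y| ≤ |a i * x| + |b i * y| := abs_add_le _ _
      _ = |a i| * |x| + |b i| * |y| := by rw [abs_mul, abs_mul]
      _ ≤ |a i| * δ + |b i| * δ := by gcongr
      _ = (|a i| + |b i|) * δ := by ring
      _ ≤ S * δ := by gcongr
      _ < δ₀ := by rw [← hSδ]; linarith
  -- The cutoff at `1 / 2` makes the logarithm continuous on all of `ℝ` and is inactive near `0`.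
  set ψ : ι → ℝ → ℝ := fun i t => Real.log (max ‖φ i t‖ (1 / 2)) with hψ
  have hψc : ∀ i, Continuous (ψ i) := fun i =>
    ((hφc i).norm.max continuous_const).log fun t => by positivity
  have hψe : ∀ i ∈ s, ∀ x y, |x| < δ → |y| < δ →
      ψ i (a i * x + b i * y) = Real.log ‖φ i (a i * x + b i * y)‖ := by
    intro i hi x y hx hy
    simp only [hψ]
    rw [max_eq_left (hsmall i hi x y hx hy).le]
  have hδ0 : |(0 : ℝ)| < δ := by simpa using hδpos
  have hsum : ∀ x y, |x| < δ → |y| < δ → ∑ i ∈ s, ψ i (a i * x + b i * y)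
      = ∑ i ∈ s, ψ i (a i * x) + ∑ i ∈ s, ψ i (b i * y) := by
    intro x y hx hy
    have e1 : ∀ i ∈ s, ψ i (a i * x) = Real.log ‖φ i (a i * x)‖ := fun i hi => by
      simpa using hψe i hi x 0 hx hδ0
    have e2 : ∀ i ∈ s, ψ i (b i * y) = Real.log ‖φ i (b i * y)‖ := fun i hi => by
      simpa using hψe i hi 0 y hδ0 hy
    have n0 : ∀ i ∈ s, ‖φ i (a i * x + b i * y)‖ ≠ 0 := fun i hi => by
      have := hsmall i hi x y hx hy
      positivity
    have n1 : ∀ i ∈ s, ‖φ i (a i * x)‖ ≠ 0 := fun i hi => by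
      have := hsmall i hi x 0 hx hδ0
      simp only [mul_zero, add_zero] at this
      positivity
    have n2 : ∀ i ∈ s, ‖φ i (b i * y)‖ ≠ 0 := fun i hi => by
      have := hsmall i hi 0 y hδ0 hy
      simp only [mul_zero, zero_add] at this
      positivity
    rw [Finset.sum_congr rfl fun i hi => hψe i hi x y hx hy, Finset.sum_congr rfl e1,
      Finset.sum_congr rfl e2, ← Real.log_prod n0, ← Real.log_prod n1, ← Real.log_prod n2,
      ← Real.log_mul (Finset.prod_ne_zero_iff.2 n1) (Finset.prod_ne_zero_iff.2 n2),
      ← norm_prod, ← norm_prod, ← norm_prod, ← norm_mul, h]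
  set G : ℝ → ℝ → ℝ := fun r z => ∑ i ∈ s with a i ≠ 0 ∧ b i / a i = r, ψ i (a i * z) with hG
  set A : ℝ → ℝ := fun x => ∑ i ∈ s, ψ i (a i * x) with hA
  -- The ratio `0` is always included, so that `A x` counts as a function of `x + 0 * y`; it
  -- survives the erasure because `r₀ ≠ 0`. Components with `a i = 0` depend on `y` alone.
  set T₀ : Finset ℝ := insert 0 ((s.filter fun i => a i ≠ 0).image fun i => b i / a i) with hT₀
  obtain ⟨n, hn⟩ := exists_isPolynomialNear_of_sum_eq_zero (T₀.erase r₀) r₀ (by simp)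
  obtain ⟨δ', hδ', hpoly⟩ := hn δ hδpos
  have hfiber : ∀ x y, ∑ r ∈ T₀, G r (x + r * y)
      = ∑ i ∈ s with a i ≠ 0, ψ i (a i * x + b i * y) := by
    intro x y
    rw [← Finset.sum_fiberwise_of_maps_to (s := s.filter fun i => a i ≠ 0) (t := T₀)
      (g := fun i => b i / a i)
      (fun i hi => Finset.mem_insert_of_mem (Finset.mem_image_of_mem _ hi))]
    refine Finset.sum_congr rfl fun r _ => ?_
    simp only [hG]
    rw [Finset.filter_filter]
    refine Finset.sum_congr rfl fun i hi => ?_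
    obtain ⟨_, hai, hri⟩ := Finset.mem_filter.1 hi
    congr 1
    rw [← hri]
    field_simp
  have hG0 : r₀ ∉ T₀ → ∀ z, G r₀ z = 0 := by
    intro hr z
    refine Finset.sum_eq_zero fun i hi => ?_
    obtain ⟨his, hai, hri⟩ := Finset.mem_filter.1 hi
    exact absurd (Finset.mem_insert_of_mem (Finset.mem_image.2
      ⟨i, Finset.mem_filter.2 ⟨his, hai⟩, hri⟩)) hr
  have herase : ∀ x y, G r₀ (x + r₀ * y) + ∑ r ∈ T₀.erase r₀, G r (x + r * y)
      = ∑ r ∈ T₀, G r (x + r * y) := by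
    intro x y
    by_cases hr : r₀ ∈ T₀
    · rw [Finset.add_sum_erase _ (fun r => G r (x + r * y)) hr]
    · rw [hG0 hr, zero_add, Finset.erase_eq_of_notMem hr]
  have h0mem : (0 : ℝ) ∈ T₀.erase r₀ := by simp [hT₀, hr₀.symm]
  obtain ⟨p, -, hp⟩ := hpoly (G r₀) (fun r z => G r z - if r = 0 then A z else 0)
    (fun y => ∑ i ∈ s with ¬ a i ≠ 0, ψ i (b i * y) - ∑ i ∈ s, ψ i (b i * y))
    (continuous_finsetSum _ fun i _ => (hψc i).comp (by fun_prop)) (by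
      intro x y hx hy
      have h1 := hsum x y hx hy
      rw [← Finset.sum_filter_add_sum_filter_not s (fun i => a i ≠ 0)
        (fun i => ψ i (a i * x + b i * y)), ← hfiber, ← herase] at h1
      have h2 : ∑ i ∈ s with ¬ a i ≠ 0, ψ i (a i * x + b i * y)
          = ∑ i ∈ s with ¬ a i ≠ 0, ψ i (b i * y) := by
        refine Finset.sum_congr rfl fun i hi => ?_
        have : a i = 0 := not_not.1 (Finset.mem_filter.1 hi).2
        rw [this, zero_mul, zero_add]
      rw [h2] at h1
      rw [Finset.sum_sub_distrib, Finset.sum_ite_eq' (T₀.erase r₀) 0, if_pos h0mem,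
        zero_mul, add_zero]
      linarith)
  refine ⟨p, min δ δ', lt_min hδpos hδ', fun t ht => ?_⟩
  rw [← hp t (ht.trans_le (min_le_right _ _)), hG]
  simp only
  rw [Real.exp_sum]
  refine Finset.prod_congr rfl fun i hi => ?_
  have h1 := hψe i (Finset.mem_filter.1 hi).1 t 0 (ht.trans_le (min_le_left _ _)) hδ0
  have h2 := hsmall i (Finset.mem_filter.1 hi).1 t 0 (ht.trans_le (min_le_left _ _)) hδ0
  simp only [mul_zero, add_zero] at h1 h2
  rw [h1, Real.exp_log (by linarith)]

/-- Convolution collects any number of factors into one law, so Cramér's theorem for two factors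
suffices. -/
theorem exists_charFun_eq_prod [DecidableEq ι] (s : Finset ι) (ν : ι → Measure ℝ)
    [∀ i, IsProbabilityMeasure (ν i)] :
    ∃ κ : Measure ℝ, IsProbabilityMeasure κ ∧ ∀ t, charFun κ t = ∏ i ∈ s, charFun (ν i) t := by
  induction s using Finset.induction_on with
  | empty => exact ⟨Measure.dirac 0, inferInstance, fun t => by simp [charFun_dirac]⟩
  | insert i s hi ih =>
    obtain ⟨κ, hκ, h⟩ := ih
    exact ⟨(ν i).conv κ, inferInstance, fun t => by
      rw [charFun_conv, Finset.prod_insert hi, h]⟩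

variable {Ω : Type*} [MeasurableSpace Ω] {μ : Measure Ω}

theorem charFun_map_sum_mul {X : ι → Ω → ℝ} (hX : ∀ i, Measurable (X i)) (hind : iIndepFun X μ)
    (s : Finset ι) (c : ι → ℝ) (t : ℝ) :
    charFun (μ.map fun ω => ∑ i ∈ s, c i * X i ω) t = ∏ i ∈ s, charFun (μ.map (X i)) (c i * t) := by
  have hind' : iIndepFun (fun i ω => c i * X i ω) μ :=
    hind.comp (fun i x => c i * x) (fun i => by fun_prop)
  rw [(hind'.restrict s).charFun_map_fun_finsetSum_eq_prod (fun i _ => by fun_prop),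
    Finset.prod_apply]
  exact Finset.prod_congr rfl fun i _ => charFun_map_mul_comp (hX i).aemeasurable _ _

theorem ProbabilityTheory.HasGaussianLaw.charFun_map_eq_exp {Y : Ω → ℝ} (hY : HasGaussianLaw Y μ) (t : ℝ) :
    charFun (μ.map Y) t
      = Complex.exp (t * (μ[Y] : ℝ) * Complex.I - (variance Y μ : ℝ) * t ^ 2 / 2) := by
  rw [hY.map_eq_gaussianReal, charFun_gaussianReal, Real.coe_toNNReal _ (variance_nonneg _ _)]

variable [IsProbabilityMeasure μ]

/-- The functional equation of the characteristic functions of the components of independent linear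
forms. -/
theorem prod_charFun_of_indepFun {X : ι → Ω → ℝ} (hX : ∀ i, Measurable (X i))
    (hind : iIndepFun X μ) (s : Finset ι) (a b : ι → ℝ)
    (h : IndepFun (fun ω => ∑ i ∈ s, a i * X i ω) (fun ω => ∑ i ∈ s, b i * X i ω) μ) (x y : ℝ) :
    ∏ i ∈ s, charFun (μ.map (X i)) (a i * x + b i * y)
      = (∏ i ∈ s, charFun (μ.map (X i)) (a i * x)) *
        ∏ i ∈ s, charFun (μ.map (X i)) (b i * y) := by
  have h1 := charFun_map_sum_mul hX hind s (fun i => a i * x + b i * y) 1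
  have h2 := charFun_map_sum_mul hX hind s (fun i => a i * x) 1
  have h3 := charFun_map_sum_mul hX hind s (fun i => b i * y) 1
  simp only [mul_one] at h1 h2 h3
  rw [← h1, ← h2, ← h3]
  have hc : ∀ (c : ι → ℝ) (z : ℝ), (fun ω => ∑ i ∈ s, c i * z * X i ω)
      = fun ω => z * ∑ i ∈ s, c i * X i ω := fun c z => by
    funext ω
    rw [Finset.mul_sum]
    exact Finset.sum_congr rfl fun i _ => by ring
  have hxy : IndepFun (fun ω => ∑ i ∈ s, a i * x * X i ω) (fun ω => ∑ i ∈ s, b i * y * X i ω) μ := by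
    rw [hc, hc]
    exact h.comp (φ := fun z => x * z) (ψ := fun z => y * z) (by fun_prop) (by fun_prop)
  have hadd : (fun ω => ∑ i ∈ s, (a i * x + b i * y) * X i ω)
      = fun ω => ∑ i ∈ s, a i * x * X i ω + ∑ i ∈ s, b i * y * X i ω := by
    funext ω
    rw [← Finset.sum_add_distrib]
    exact Finset.sum_congr rfl fun i _ => by ring
  rw [hadd, hxy.charFun_map_fun_add_eq_mul (by fun_prop) (by fun_prop), Pi.mul_apply]

/-- The **Darmois–Skitovich theorem**: the common components of two independent linear forms in
independent random variables are Gaussian. -/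
theorem hasGaussianLaw_of_indepFun_sum {X : ι → Ω → ℝ} (hX : ∀ i, Measurable (X i))
    (hind : iIndepFun X μ) (s : Finset ι) (a b : ι → ℝ)
    (h : IndepFun (fun ω => ∑ i ∈ s, a i * X i ω) (fun ω => ∑ i ∈ s, b i * X i ω) μ)
    {i₀ : ι} (hi₀ : i₀ ∈ s) (ha : a i₀ ≠ 0) (hb : b i₀ ≠ 0) : HasGaussianLaw (X i₀) μ := by
  classical
  have hprob : ∀ i, IsProbabilityMeasure (μ.map (X i)) := fun i =>
    Measure.isProbabilityMeasure_map (hX i).aemeasurable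
  set φ : ι → ℝ → ℂ := fun i => charFun (μ.map (X i)) with hφ
  obtain ⟨p, δ, hδ, hp⟩ := exists_polynomial_sum_log_norm s φ (fun i => continuous_charFun)
    (fun i => by simp [hφ]) a b (prod_charFun_of_indepFun hX hind s a b h) (div_ne_zero hb ha)
  set G := s.filter fun i => a i ≠ 0 ∧ b i / a i = b i₀ / a i₀ with hG
  have hiG : i₀ ∈ G := Finset.mem_filter.2 ⟨hi₀, ha, rfl⟩
  have hcm : ∀ c i, IsProbabilityMeasure (μ.map fun ω => c * X i ω) := fun c i =>
    Measure.isProbabilityMeasure_map ((hX i).const_mul c).aemeasurable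
  have hcf : ∀ c i t, charFun (μ.map fun ω => c * X i ω) t = φ i (c * t) := fun c i t =>
    charFun_map_mul_comp (hX i).aemeasurable c t
  -- Symmetrising each component replaces its characteristic function by the squared modulus, where
  -- the polynomial formula applies. One unsymmetrised factor of `i₀` is kept as `ν₁`; everything
  -- else becomes `ν₂`.
  obtain ⟨κ, hκ, hκe⟩ := exists_charFun_eq_prod (G.erase i₀)
    (fun i => (μ.map fun ω => a i * X i ω).conv (μ.map fun ω => -a i * X i ω))
  have hsq : ∀ i t, φ i (a i * t) * φ i (-a i * t) = ((‖φ i (a i * t)‖ ^ 2 : ℝ) : ℂ) := by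
    intro i t
    rw [neg_mul, hφ]
    simp only
    rw [charFun_neg, Complex.mul_conj, Complex.normSq_eq_norm_sq]
  have hgauss : IsGaussian (μ.map fun ω => a i₀ * X i₀ ω) := by
    refine isGaussian_of_charFun_mul_eq_exp (ν₂ := (μ.map fun ω => -a i₀ * X i₀ ω).conv κ)
      ((2 * p).map (algebraMap ℝ ℂ)) hδ fun t ht => ?_
    rw [charFun_conv, hκe, hcf, hcf, ← mul_assoc]
    simp only [charFun_conv, hcf, hsq]
    rw [Finset.mul_prod_erase G (fun i => ((‖φ i (a i * t)‖ ^ 2 : ℝ) : ℂ)) hiG,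
      ← Complex.ofReal_prod, Finset.prod_pow, hp t ht, ← Real.exp_nat_mul]
    have : Polynomial.eval (t : ℂ) ((2 * p).map (algebraMap ℝ ℂ)) = ((2 * p.eval t : ℝ) : ℂ) := by
      rw [Polynomial.eval_map_algebraMap, Complex.coe_algebraMap.symm,
        Polynomial.aeval_algebraMap_apply]
      simp
    rw [this, Complex.ofReal_exp]
    push_cast
    rfl
  have hlaw : HasGaussianLaw (fun ω => a i₀ * X i₀ ω) μ := ⟨hgauss⟩
  have := hlaw.fun_smul (a i₀)⁻¹
  simpa [← mul_assoc, inv_mul_cancel₀ ha] using this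

/-- Independent linear forms in independent random variables are uncorrelated, where only the
(Gaussian) common components contribute. -/
theorem sum_mul_variance_eq_zero_of_indepFun {X : ι → Ω → ℝ} (hX : ∀ i, Measurable (X i))
    (hind : iIndepFun X μ) (s : Finset ι) (a b : ι → ℝ)
    (h : IndepFun (fun ω => ∑ i ∈ s, a i * X i ω) (fun ω => ∑ i ∈ s, b i * X i ω) μ) :
    ∑ i ∈ s, a i * b i * variance (X i) μ = 0 := by
  classical
  have hprob : ∀ i, IsProbabilityMeasure (μ.map (X i)) := fun i =>
    Measure.isProbabilityMeasure_map (hX i).aemeasurable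
  set φ : ι → ℝ → ℂ := fun i => charFun (μ.map (X i)) with hφ
  have hfe : ∀ x, ∏ i ∈ s, φ i (a i * x + b i * x)
      = (∏ i ∈ s, φ i (a i * x)) * ∏ i ∈ s, φ i (b i * x) :=
    fun x => prod_charFun_of_indepFun hX hind s a b h x x
  -- Components with `a i * b i = 0` contribute the factor `1` whatever their moments; the others
  -- are Gaussian.
  have hkey : ∀ i ∈ s, ∀ x : ℝ, φ i (a i * x + b i * x)
      = φ i (a i * x) * φ i (b i * x) * ((Real.exp (-(a i * b i * variance (X i) μ * x ^ 2)) : ℝ) : ℂ) := by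
    intro i hi x
    by_cases ha : a i = 0
    · simp [ha, hφ]
    by_cases hb : b i = 0
    · simp [hb, hφ]
    have hg := hasGaussianLaw_of_indepFun_sum hX hind s a b h hi ha hb
    simp only [hφ]
    rw [hg.charFun_map_eq_exp, hg.charFun_map_eq_exp, hg.charFun_map_eq_exp, Complex.ofReal_exp,
      ← Complex.exp_add, ← Complex.exp_add]
    congr 1
    push_cast
    ring
  have hev : ∀ᶠ t : ℝ in 𝓝[>] 0, ∀ i ∈ s, φ i (a i * t) ≠ 0 ∧ φ i (b i * t) ≠ 0 := by
    refine Filter.Eventually.filter_mono nhdsWithin_le_nhds ?_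
    rw [Filter.eventually_all_finset]
    intro i _
    have hc : ∀ c : ℝ, ∀ᶠ t : ℝ in 𝓝 0, φ i (c * t) ≠ 0 := fun c => by
      have : Continuous fun t : ℝ => φ i (c * t) := continuous_charFun.comp (by fun_prop)
      refine this.continuousAt.eventually_ne ?_
      simp [hφ]
    exact (hc _).and (hc _)
  -- A small `x > 0` where no characteristic function vanishes, so that the product can be
  -- cancelled.
  obtain ⟨x, hx, hx0⟩ := (hev.and self_mem_nhdsWithin).exists
  have hx0 : 0 < x := hx0
  have h1 := hfe x
  rw [Finset.prod_congr rfl fun i hi => hkey i hi x, Finset.prod_mul_distrib,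
    Finset.prod_mul_distrib, ← Complex.ofReal_prod, ← Real.exp_sum] at h1
  have hne : (∏ i ∈ s, φ i (a i * x)) * ∏ i ∈ s, φ i (b i * x) ≠ 0 :=
    mul_ne_zero (Finset.prod_ne_zero_iff.2 fun i hi => (hx i hi).1)
      (Finset.prod_ne_zero_iff.2 fun i hi => (hx i hi).2)
  have h2 := (mul_eq_left₀ hne).1 h1
  have h3 : ∑ i ∈ s, -(a i * b i * variance (X i) μ * x ^ 2) = 0 := by
    rw [← Real.exp_eq_one_iff]
    exact_mod_cast h2
  rw [Finset.sum_neg_distrib, neg_eq_zero, ← Finset.sum_mul] at h3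
  exact (mul_eq_zero.1 h3).resolve_right (by positivity)

end DarmoisSkitovich

/-! ### Disjoint linear forms and degenerate laws. -/

section Independence

variable {ι Ω : Type*} [MeasurableSpace Ω] {μ : Measure Ω}

theorem sum_eq_sum_filter_ne_zero (s : Finset ι) (c y : ι → ℝ) [DecidablePred fun i => c i ≠ 0] :
    ∑ i ∈ s, c i * y i = ∑ i : ↥(s.filter fun i => c i ≠ 0), c i.1 * y i.1 := by
  rw [Finset.sum_coe_sort (s.filter fun i => c i ≠ 0) (fun i => c i * y i), Finset.sum_filter]
  refine Finset.sum_congr rfl fun i _ => ?_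
  by_cases hc : c i = 0 <;> simp [hc]

/-- A linear form is independent of the family of all variables that do not occur in it. -/
theorem indepFun_sum_finset_of_eq_zero {X : ι → Ω → ℝ}
    (hX : ∀ i, Measurable (X i)) (hind : iIndepFun X μ) (s T : Finset ι) (c : ι → ℝ)
    (h : ∀ i ∈ T, c i = 0) :
    IndepFun (fun ω => ∑ i ∈ s, c i * X i ω) (fun ω (i : T) => X i ω) μ := by
  classical
  have hdisj : Disjoint (s.filter fun i => c i ≠ 0) T := by
    rw [Finset.disjoint_left]
    intro i hi hiT
    exact (Finset.mem_filter.1 hi).2 (h i hiT)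
  simp only [sum_eq_sum_filter_ne_zero s c]
  exact (hind.indepFun_finset _ T hdisj hX).comp
    (φ := fun v : ↥(s.filter fun i => c i ≠ 0) → ℝ => ∑ i, c i.1 * v i)
    (ψ := id) (by fun_prop) measurable_id

/-- Linear forms without common components are independent. -/
theorem indepFun_sum_sum_of_mul_eq_zero {X : ι → Ω → ℝ}
    (hX : ∀ i, Measurable (X i)) (hind : iIndepFun X μ) (s : Finset ι) (a b : ι → ℝ)
    (h : ∀ i ∈ s, a i * b i = 0) :
    IndepFun (fun ω => ∑ i ∈ s, a i * X i ω) (fun ω => ∑ i ∈ s, b i * X i ω) μ := by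
  classical
  have h1 := indepFun_sum_finset_of_eq_zero hX hind s (s.filter fun i => b i ≠ 0) a fun i hi => by
    obtain ⟨his, hb⟩ := Finset.mem_filter.1 hi
    exact (mul_eq_zero.1 (h i his)).resolve_right hb
  simp only [sum_eq_sum_filter_ne_zero s b]
  exact h1.comp (φ := id)
    (ψ := fun v : ↥(s.filter fun i => b i ≠ 0) → ℝ => ∑ i, b i.1 * v i) measurable_id (by fun_prop)

theorem HasPosTwiceDiffDensity.not_ae_eq_const [IsProbabilityMeasure μ] {Y : Ω → ℝ}
    (h : HasPosTwiceDiffDensity (μ.map Y)) :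
    ¬ ∃ c : ℝ, Y =ᵐ[μ] fun _ => c := by
  rintro ⟨c, hc⟩
  obtain ⟨p, -, -, -, hp⟩ := h
  have hac : μ.map Y ≪ volume := hp ▸ withDensity_absolutelyContinuous _ _
  rw [Measure.map_congr hc, Measure.map_const, measure_univ, one_smul] at hac
  have := hac (Real.volume_singleton (a := c))
  simp at this

/-- A Gaussian variable is square integrable, so a zero variance is not the default value of an
infinite one. -/
theorem ProbabilityTheory.HasGaussianLaw.ae_eq_const_of_variance_eq_zero {Y : Ω → ℝ}
    (h : HasGaussianLaw Y μ) (hv : variance Y μ = 0) : ∃ c : ℝ, Y =ᵐ[μ] fun _ => c := by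
  have := h.isProbabilityMeasure
  refine ⟨μ[Y], (evariance_eq_zero_iff h.aemeasurable).1 ?_⟩
  rw [← h.memLp_two.ofReal_variance_eq, hv, ENNReal.ofReal_zero]

end Independence

/-! ### The model as linear forms in its roots. -/

namespace LinearC2L

variable {Ω : Type*} [MeasurableSpace Ω] {μ : Measure Ω} (M : LinearC2L Ω μ)

/-- The family of all confounders and noise terms. -/
def root : ℕ ⊕ (ℕ ⊕ ℕ) → Ω → ℝ := Sum.elim M.u (Sum.elim M.eS M.eA)

theorem measurable_root (x : ℕ ⊕ (ℕ ⊕ ℕ)) : Measurable (M.root x) := by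
  rcases x with j | i | i
  exacts [M.measurable_u j, M.measurable_eS i, M.measurable_eA i]

/-- The indices of the roots before time `N`. -/
def rootsBefore (N : ℕ) : Finset (ℕ ⊕ (ℕ ⊕ ℕ)) :=
  (Finset.range N).disjSum ((Finset.range N).disjSum (Finset.range N))

theorem sum_rootsBefore {R : Type*} [AddCommMonoid R] (N : ℕ) (f : ℕ ⊕ (ℕ ⊕ ℕ) → R) :
    ∑ x ∈ rootsBefore N, f x = ∑ j ∈ Finset.range N, f (.inl j) +
      (∑ i ∈ Finset.range N, f (.inr (.inl i)) + ∑ i ∈ Finset.range N, f (.inr (.inr i))) := by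
  simp [rootsBefore, Finset.sum_disjSum]

/-- The one-step effect of a state on the next one. -/
def stateEffect : ℝ := M.ρss + M.ρas * M.ρsa

/-- The coefficients of the roots in the state `s_k`. -/
noncomputable def stateCoeff (k : ℕ) : ℕ ⊕ (ℕ ⊕ ℕ) → ℝ
  | .inl j => M.confounderEffect j k
  | .inr (.inl i) => if i ≤ k then M.stateEffect ^ (k - i) else 0
  | .inr (.inr i) => if i < k then M.ρas * M.stateEffect ^ (k - 1 - i) else 0

/-- The part of the action `a_t` that is not caused by `s_t`. -/
noncomputable def disturbance (t : ℕ) (ω : Ω) : ℝ := M.confounding t ω + M.eA t ω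

/-- The coefficients of the roots in the disturbance of `a_t`. -/
noncomputable def disturbanceCoeff (t : ℕ) : ℕ ⊕ (ℕ ⊕ ℕ) → ℝ
  | .inl j => if j ∈ Finset.Icc (t - M.τ) t then M.ρua (t - j) else 0
  | .inr (.inl _) => 0
  | .inr (.inr i) => if i = t then 1 else 0

theorem disturbance_eq_sum {t N : ℕ} (h : t < N) (ω : Ω) :
    M.disturbance t ω = ∑ x ∈ rootsBefore N, M.disturbanceCoeff t x * M.root x ω := by
  rw [sum_rootsBefore]
  simp only [disturbanceCoeff, root, Sum.elim_inl, Sum.elim_inr, ite_mul, zero_mul, one_mul,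
    Finset.sum_const_zero, zero_add, Finset.sum_ite_eq', Finset.mem_range, h, if_true]
  rw [disturbance, confounding, ← Finset.sum_filter]
  congr 2
  ext j
  simp only [Finset.mem_filter, Finset.mem_range, Finset.mem_Icc]
  omega

/-- The recursion `s_{k+1} = β * s_k + ρas * D_k + eS (k+1)` read off on coefficients. -/
theorem stateCoeff_succ (k : ℕ) (x : ℕ ⊕ (ℕ ⊕ ℕ)) :
    M.stateCoeff (k + 1) x = M.stateEffect * M.stateCoeff k x + M.ρas * M.disturbanceCoeff k x +
      if x = .inr (.inl (k + 1)) then 1 else 0 := by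
  rcases x with j | i | i
  · simp [stateCoeff, disturbanceCoeff, confounderEffect, stateEffect]
  · simp only [stateCoeff, disturbanceCoeff, Sum.inr.injEq, Sum.inl.injEq]
    rcases lt_trichotomy i (k + 1) with h | h | h
    · have h1 : k + 1 - i = (k - i) + 1 := by omega
      simp [h.le, Nat.lt_succ_iff.1 h, h.ne, h1, pow_succ']
    · simp [h]
    · have h1 : ¬ i ≤ k := by omega
      have h2 : ¬ i ≤ k + 1 := by omega
      simp [h1, h2, h.ne']
  · simp only [stateCoeff, disturbanceCoeff]
    rcases lt_trichotomy i k with h | h | h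
    · have h1 : k - i = (k - 1 - i) + 1 := by omega
      have h2 : i < k + 1 := by omega
      simp only [h, h2, h.ne, if_true, if_false, Nat.add_sub_cancel, h1, pow_succ']
      simp
      ring
    · simp [h]
    · have h1 : ¬ i < k := by omega
      have h2 : ¬ i < k + 1 := by omega
      simp [h1, h2, h.ne']

theorem s_eq_sum {k N : ℕ} (h : k < N) (ω : Ω) :
    M.s k ω = ∑ x ∈ rootsBefore N, M.stateCoeff k x * M.root x ω := by
  induction k with
  | zero =>
    rw [sum_rootsBefore]
    simp [stateCoeff, confounderEffect, root, s, h]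
  | succ k ih =>
    have hs : M.s (k + 1) ω
        = M.stateEffect * M.s k ω + M.ρas * M.disturbance k ω + M.eS (k + 1) ω := by
      simp only [s, stateEffect, disturbance]
      ring
    have he : M.eS (k + 1) ω = ∑ x ∈ rootsBefore N,
        (if x = .inr (.inl (k + 1)) then 1 else 0) * M.root x ω := by
      rw [sum_rootsBefore]
      simp [root, h]
    rw [hs, ih (by omega), M.disturbance_eq_sum (by omega : k < N), he, Finset.mul_sum,
      Finset.mul_sum, ← Finset.sum_add_distrib, ← Finset.sum_add_distrib]
    refine Finset.sum_congr rfl fun x _ => ?_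
    rw [stateCoeff_succ]
    ring

theorem measurable_s (k : ℕ) : Measurable (M.s k) := by
  have : M.s k = fun ω => ∑ x ∈ rootsBefore (k + 1), M.stateCoeff k x * M.root x ω :=
    funext (M.s_eq_sum (Nat.lt_succ_self k))
  rw [this]
  exact Finset.measurable_sum _ fun x _ => (M.measurable_root x).const_mul _

theorem measurable_disturbance (t : ℕ) : Measurable (M.disturbance t) := by
  have : M.disturbance t = fun ω => ∑ x ∈ rootsBefore (t + 1), M.disturbanceCoeff t x * M.root x ω :=
    funext (M.disturbance_eq_sum (Nat.lt_succ_self t))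
  rw [this]
  exact Finset.measurable_sum _ fun x _ => (M.measurable_root x).const_mul _

theorem integrable_disturbance (t : ℕ) : Integrable (M.disturbance t) μ :=
  (integrable_finsetSum _ fun j _ => (M.integrable_u j).const_mul _).add (M.integrable_eA t)

theorem integral_disturbance (t : ℕ) : ∫ ω, M.disturbance t ω ∂μ = 0 := by
  have hc : Integrable (M.confounding t) μ :=
    integrable_finsetSum _ fun j _ => (M.integrable_u j).const_mul _
  simp only [disturbance]
  rw [integral_add hc (M.integrable_eA t), M.mean_eA]
  simp only [confounding]
  rw [integral_finsetSum _ fun j _ => (M.integrable_u j).const_mul _]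
  simp [integral_const_mul, M.mean_u]

theorem hasGaussianLaw_u_iff (i j : ℕ) : HasGaussianLaw (M.u i) μ ↔ HasGaussianLaw (M.u j) μ := by
  have h : μ.map (M.u i) = μ.map (M.u j) :=
    (M.identDistrib_u i).map_eq.trans (M.identDistrib_u j).map_eq.symm
  exact ⟨fun hg => ⟨h ▸ hg.isGaussian_map⟩, fun hg => ⟨h ▸ hg.isGaussian_map⟩⟩

/-- Every directed path to `a_t` that does not start at a confounder passes through `s_t`. -/
theorem not_transGen_avoiding (k t : ℕ) :
    ¬ Relation.TransGen (fun x y => M.Edge x y ∧ x ≠ Node.S t) (.S k) (.A t) := by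
  intro h
  obtain ⟨y, hy, hyA, hyS⟩ := Relation.TransGen.tail'_iff.1 h
  cases hyA with
  | sa => exact hyS rfl
  | ua j i =>
    -- No edge ends at a confounder, and the path starts at a state.
    cases hy with
    | tail _ h2 => nomatch h2.1

/-- No confounder acts on both `s_k` and `a_t`. -/
def NoCommonConfounder (k t : ℕ) : Prop :=
  ∀ j ∈ Finset.Icc (t - M.τ) t, M.confounderEffect j k * M.ρua (t - j) = 0

variable {M}

theorem NoCommonConfounder.confounderEffect_eq_zero {k t : ℕ} (h : M.NoCommonConfounder k t)
    {j : ℕ} (hj : j ∈ M.confounderTimes t) : M.confounderEffect j k = 0 :=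
  (mul_eq_zero.1 (h j hj.1)).resolve_right hj.2

theorem NoCommonConfounder.indepFun_confounders {k t : ℕ} (h : M.NoCommonConfounder k t) :
    IndepFun (M.s k) (fun ω (j : M.confounderTimes t) => M.u j ω) μ := by
  classical
  set T : Finset (ℕ ⊕ (ℕ ⊕ ℕ)) :=
    ((Finset.Icc (t - M.τ) t).filter fun j => M.ρua (t - j) ≠ 0).image Sum.inl with hT
  have hmem : ∀ j : M.confounderTimes t, Sum.inl (j : ℕ) ∈ T := fun j =>
    Finset.mem_image_of_mem _ (Finset.mem_filter.2 j.2)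
  have h1 := indepFun_sum_finset_of_eq_zero M.measurable_root M.indep (rootsBefore (k + 1)) T
    (M.stateCoeff k) fun x hx => by
      obtain ⟨j, hj, rfl⟩ := Finset.mem_image.1 hx
      exact h.confounderEffect_eq_zero (Finset.mem_filter.1 hj)
  rw [← funext (M.s_eq_sum (Nat.lt_succ_self k))] at h1
  exact h1.comp (φ := id) (ψ := fun (v : T → ℝ) (j : M.confounderTimes t) => v ⟨_, hmem j⟩)
    measurable_id (measurable_pi_lambda _ fun j => measurable_pi_apply _)

/-- Besides confounders, the only root of the disturbance is `eA t`, which acts only on states after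
time `t`. -/
theorem NoCommonConfounder.indepFun_disturbance {k t : ℕ} (hkt : k < t)
    (h : M.NoCommonConfounder k t) : IndepFun (M.disturbance t) (M.s k) μ := by
  have h1 := indepFun_sum_sum_of_mul_eq_zero M.measurable_root M.indep (rootsBefore (t + 1))
    (M.disturbanceCoeff t) (M.stateCoeff k) fun x _ => by
      rcases x with j | i | i
      · simp only [disturbanceCoeff, stateCoeff, ite_mul, zero_mul]
        split_ifs with hj
        · rw [mul_comm]; exact h j hj
        · rfl
      · simp [disturbanceCoeff]
      · by_cases hi : i = t
        · have : ¬ t < k := by omega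
          simp [stateCoeff, hi, this]
        · simp [disturbanceCoeff, hi]
  rwa [← funext (M.disturbance_eq_sum (Nat.lt_succ_self t)),
    ← funext (M.s_eq_sum (by omega : k < t + 1))] at h1

/-! ### Consequences of independence from `s_k`. -/

variable [IsProbabilityMeasure μ]

theorem variance_u_ne_zero {j : ℕ} (hu : HasPosTwiceDiffDensity (μ.map (M.u j)))
    (hg : HasGaussianLaw (M.u j) μ) : variance (M.u j) μ ≠ 0 := fun h0 =>
  hu.not_ae_eq_const (hg.ae_eq_const_of_variance_eq_zero h0)

/-- A confounder that is independent of `s_k` has no effect on `s_k`. -/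
theorem confounderEffect_eq_zero_of_indepFun {j k t : ℕ} (hk : k ≤ t) (hj : j ≤ t)
    (hu : HasPosTwiceDiffDensity (μ.map (M.u j))) (h : IndepFun (M.s k) (M.u j) μ) :
    M.confounderEffect j k = 0 := by
  have hjmem : Sum.inl j ∈ rootsBefore (t + 1) := by
    simp [rootsBefore]; omega
  have hform : M.u j = fun ω => ∑ x ∈ rootsBefore (t + 1),
      (if x = .inl j then 1 else 0) * M.root x ω := by
    funext ω
    simp only [ite_mul, one_mul, zero_mul]
    rw [Finset.sum_ite_eq', if_pos hjmem]
    rfl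
  rw [funext (M.s_eq_sum (by omega : k < t + 1)), hform] at h
  by_contra hne
  have hg : HasGaussianLaw (M.u j) μ := hasGaussianLaw_of_indepFun_sum M.measurable_root M.indep
    _ _ _ h hjmem (i₀ := .inl j) hne (by simp)
  have hcov := sum_mul_variance_eq_zero_of_indepFun M.measurable_root M.indep _ _ _ h
  simp only [mul_ite, mul_one, mul_zero, ite_mul, zero_mul] at hcov
  rw [Finset.sum_ite_eq', if_pos hjmem] at hcov
  exact mul_ne_zero hne (variance_u_ne_zero hu hg) hcov

theorem noCommonConfounder_of_indepFun_confounders {k t : ℕ} (hkt : k < t)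
    (hu : ∀ j, HasPosTwiceDiffDensity (μ.map (M.u j)))
    (h : IndepFun (M.s k) (fun ω (j : M.confounderTimes t) => M.u j ω) μ) :
    M.NoCommonConfounder k t := by
  intro j hj
  by_cases hρ : M.ρua (t - j) = 0
  · rw [hρ, mul_zero]
  · have h1 : IndepFun (M.s k) (M.u j) μ := h.comp (φ := id)
      (ψ := fun v : M.confounderTimes t → ℝ => v ⟨j, hj, hρ⟩) measurable_id (measurable_pi_apply _)
    rw [confounderEffect_eq_zero_of_indepFun hkt.le (Finset.mem_Icc.1 hj).2 (hu j) h1, zero_mul]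

/-- The confounders are all Gaussian or all non-Gaussian. In the second case Darmois–Skitovich
forbids a shared one; in the first the covariance is their common nonzero variance times the sum of
contributions, and `NoCancellation` applies. -/
theorem noCommonConfounder_of_indepFun_disturbance {k t : ℕ} (hkt : k < t)
    (hu : ∀ j, HasPosTwiceDiffDensity (μ.map (M.u j)))
    (hcancel : (∀ j, HasGaussianLaw (M.u j) μ) → M.NoCancellation k t)
    (h : IndepFun (M.disturbance t) (M.s k) μ) : M.NoCommonConfounder k t := by
  rw [funext (M.s_eq_sum (by omega : k < t + 1)),
    funext (M.disturbance_eq_sum (Nat.lt_succ_self t))] at h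
  by_cases hg : HasGaussianLaw (M.u 0) μ
  · refine hcancel (fun j => (M.hasGaussianLaw_u_iff 0 j).1 hg) ?_
    have hcov := sum_mul_variance_eq_zero_of_indepFun M.measurable_root M.indep _ _ _ h
    rw [sum_rootsBefore] at hcov
    have hA : ∀ i, M.disturbanceCoeff t (.inr (.inr i)) * M.stateCoeff k (.inr (.inr i)) = 0 := by
      intro i
      by_cases hi : i = t
      · have : ¬ t < k := by omega
        simp [stateCoeff, hi, this]
      · simp [disturbanceCoeff, hi]
    have hvar : ∀ j, variance (M.u j) μ = variance (M.u 0) μ := fun j =>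
      (M.identDistrib_u j).variance_eq
    simp only [hA, zero_mul, Finset.sum_const_zero, add_zero] at hcov
    simp only [zero_mul, Finset.sum_const_zero, add_zero, disturbanceCoeff, stateCoeff, root,
      Sum.elim_inl, hvar, ite_mul] at hcov
    rw [← Finset.sum_filter, ← Finset.sum_mul] at hcov
    have hfilter : (Finset.range (t + 1)).filter (fun j => j ∈ Finset.Icc (t - M.τ) t)
        = Finset.Icc (t - M.τ) t := by
      ext j
      simp only [Finset.mem_filter, Finset.mem_range, Finset.mem_Icc]
      omega
    rw [hfilter] at hcov
    simp only [mul_comm (M.confounderEffect _ _)]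
    exact (mul_eq_zero.1 hcov).resolve_right (variance_u_ne_zero (hu 0) hg)
  · intro j hj
    by_contra hne
    refine hg ((M.hasGaussianLaw_u_iff j 0).1 ?_)
    have hjt := (Finset.mem_Icc.1 hj).2
    refine hasGaussianLaw_of_indepFun_sum M.measurable_root M.indep _ _ _ h (i₀ := .inl j)
      (by simp [rootsBefore]; omega) ?_ (left_ne_zero_of_mul hne)
    simp only [disturbanceCoeff, hj, if_true]
    exact right_ne_zero_of_mul hne

/-- A combination of the state `s_t` and the disturbance of `a_t` is not independent of an earlier
state `s_k` if the former enters with a nonzero coefficient. -/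
theorem not_indepFun_of_partialNonGaussianity {k t : ℕ} (hkt : k < t)
    (heffect : M.stateEffect ≠ 0) (hs : HasPosTwiceDiffDensity (μ.map (M.s k)))
    (hng : M.PartialNonGaussianity k t) {m : ℝ} (hm : m ≠ 0) (q : ℝ) :
    ¬ IndepFun (fun ω => m * M.s t ω + q * M.disturbance t ω) (M.s k) μ := by
  intro h
  have hform : (fun ω => m * M.s t ω + q * M.disturbance t ω) = fun ω =>
      ∑ x ∈ rootsBefore (t + 1),
        (m * M.stateCoeff t x + q * M.disturbanceCoeff t x) * M.root x ω := by
    funext ω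
    rw [M.s_eq_sum (Nat.lt_succ_self t), M.disturbance_eq_sum (Nat.lt_succ_self t),
      Finset.mul_sum, Finset.mul_sum, ← Finset.sum_add_distrib]
    exact Finset.sum_congr rfl fun x _ => by ring
  rw [hform, funext (M.s_eq_sum (by omega : k < t + 1))] at h
  set γ := m * M.stateEffect ^ (t - k) with hγ
  have hγ0 : γ ≠ 0 := mul_ne_zero hm (pow_ne_zero _ heffect)
  set a := fun x => m * M.stateCoeff t x + q * M.disturbanceCoeff t x with ha
  -- Noise present in `s_k` reaches `s_t` only through `s_k`, hence with the extra factor `β ^ (t -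
  -- k)`, and does not enter the disturbance at `t`.
  have hnoise : ∀ x, a (.inr x) * M.stateCoeff k (.inr x) = γ * M.stateCoeff k (.inr x) ^ 2 := by
    rintro (i | i)
    · by_cases hi : i ≤ k
      · have h1 : t - i = (t - k) + (k - i) := by omega
        simp only [ha, stateCoeff, disturbanceCoeff, hi, hi.trans hkt.le, if_true, h1, pow_add, hγ]
        ring
      · simp [stateCoeff, hi]
    · by_cases hi : i < k
      · have h1 : t - 1 - i = (t - k) + (k - 1 - i) := by omega
        have h2 : i ≠ t := by omega
        simp only [ha, stateCoeff, disturbanceCoeff, hi, hi.trans hkt, if_true, if_false, h1, h2,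
          pow_add, hγ]
        ring
      · simp [stateCoeff, hi]
  have hkmem : Sum.inr (Sum.inl k) ∈ rootsBefore (t + 1) := by
    simp [rootsBefore]; omega
  have hck : M.stateCoeff k (.inr (.inl k)) = 1 := by simp [stateCoeff]
  have hak : a (.inr (.inl k)) = γ := by simpa [hck] using hnoise (.inl k)
  have hgk : HasGaussianLaw (M.eS k) μ := hasGaussianLaw_of_indepFun_sum M.measurable_root M.indep
    _ _ _ h hkmem (hak.trans_ne hγ0) (by rw [hck]; exact one_ne_zero)
  obtain ⟨j₀, hj₀, -⟩ := hng.resolve_right (not_not.2 hgk)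
  have hu0 : ∀ j ∈ Finset.range (t + 1), a (.inl j) * M.stateCoeff k (.inl j) = 0 := by
    intro j hj
    by_contra hne
    refine hj₀ ((M.hasGaussianLaw_u_iff j j₀).1 ?_)
    exact hasGaussianLaw_of_indepFun_sum M.measurable_root M.indep _ _ _ h (i₀ := .inl j)
      (by simpa [rootsBefore] using hj) (left_ne_zero_of_mul hne) (right_ne_zero_of_mul hne)
  -- Without shared confounders the covariance is `γ` times a sum of nonnegative terms, one of which
  -- is the variance of `eS k`.
  have hcov := sum_mul_variance_eq_zero_of_indepFun M.measurable_root M.indep _ _ _ h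
  rw [sum_rootsBefore, Finset.sum_eq_zero (s := Finset.range (t + 1))
    (f := fun j => a (.inl j) * M.stateCoeff k (.inl j) * variance (M.root (.inl j)) μ)
    (fun j hj => by rw [hu0 j hj, zero_mul]), zero_add] at hcov
  change ∑ i ∈ Finset.range (t + 1), a (.inr (.inl i)) * _ * _
    + ∑ i ∈ Finset.range (t + 1), a (.inr (.inr i)) * _ * _ = 0 at hcov
  simp only [hnoise, mul_assoc] at hcov
  rw [← Finset.mul_sum, ← Finset.mul_sum, ← mul_add] at hcov
  have hsum := (mul_eq_zero.1 hcov).resolve_left hγ0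
  have hnn : ∀ x : ℕ ⊕ ℕ, 0 ≤ M.stateCoeff k (.inr x) ^ 2 * variance (M.root (.inr x)) μ :=
    fun x => mul_nonneg (sq_nonneg _) (variance_nonneg _ _)
  have hS := ((add_eq_zero_iff_of_nonneg (Finset.sum_nonneg fun i _ => hnn (.inl i))
    (Finset.sum_nonneg fun i _ => hnn (.inr i))).1 hsum).1
  have hvk := (Finset.sum_eq_zero_iff_of_nonneg fun i _ => hnn (.inl i)).1 hS k
    (Finset.mem_range.2 (by omega))
  rw [hck, one_pow, one_mul] at hvk
  have hconst := hgk.ae_eq_const_of_variance_eq_zero hvk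
  -- The root `eS 0` is `s_0` itself, so nondegeneracy comes from its density; later noises are
  -- nondegenerate by assumption.
  rcases Nat.eq_zero_or_pos k with rfl | hk
  · exact hs.not_ae_eq_const hconst
  · exact M.eS_nondegenerate k hk hconst

end LinearC2L

/-! ### The equivalence. -/

theorem theorem3p4 {Ω : Type*} [MeasurableSpace Ω] (μ : Measure Ω) [IsProbabilityMeasure μ]
    (M : LinearC2L Ω μ) (k t : ℕ) (hkt : k < t)
    (hpolicy : M.ρsa ≠ 0)
    (heffect : M.ρss + M.ρas * M.ρsa ≠ 0)
    (hs : HasPosTwiceDiffDensity (μ.map (M.s k)))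
    (hu : ∀ j, HasPosTwiceDiffDensity (μ.map (M.u j)))
    (hng : M.PartialNonGaussianity k t)
    (hcancel : (∀ j, HasGaussianLaw (M.u j) μ) → M.NoCancellation k t) :
    M.ABCriterion k t ↔ M.IsValidIV k t := by
  have hres : ∀ l : ℝ →ₗ[ℝ] ℝ, (fun ω => M.a t ω - l (M.s t ω))
      = fun ω => (M.ρsa - l 1) * M.s t ω + 1 * M.disturbance t ω := by
    intro l
    funext ω
    have : l (M.s t ω) = M.s t ω * l 1 := by
      rw [← smul_eq_mul, ← map_smul, smul_eq_mul, mul_one]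
    rw [this, LinearC2L.a, LinearC2L.disturbance]
    ring
  constructor
  · rintro ⟨l, -, -, -, hind⟩
    rw [hres] at hind
    have hl : M.ρsa - l 1 = 0 := by
      by_contra hm
      exact LinearC2L.not_indepFun_of_partialNonGaussianity hkt heffect hs hng hm 1 hind
    simp only [hl, zero_mul, zero_add, one_mul] at hind
    refine ⟨fun hrel => ?_, M.not_transGen_avoiding k t,
      (LinearC2L.noCommonConfounder_of_indepFun_disturbance hkt hu hcancel
        hind).indepFun_confounders⟩
    -- Relevance is the case of `s_t` alone, without the disturbance.
    refine LinearC2L.not_indepFun_of_partialNonGaussianity hkt heffect hs hng one_ne_zero 0 ?_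
    simpa using hrel.symm
  · intro hIV
    have hind : IndepFun (M.disturbance t) (M.s k) μ :=
      (LinearC2L.noCommonConfounder_of_indepFun_confounders hkt hu
        hIV.exogeneity).indepFun_disturbance hkt
    have hl : (fun ω => M.a t ω - (M.ρsa • LinearMap.id : ℝ →ₗ[ℝ] ℝ) (M.s t ω))
        = M.disturbance t := by
      rw [hres]
      simp
    -- The true policy coefficient leaves exactly the disturbance, which has mean zero; independence
    -- makes its conditional mean zero too.
    refine ⟨M.ρsa • LinearMap.id, fun h0 => hpolicy ?_, ?_, ?_, ?_⟩
    · simpa using LinearMap.congr_fun h0 1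
    · rw [hl]
      exact M.integrable_disturbance t
    · rw [hl]
      refine (condExp_indep_eq (M.measurable_disturbance t).comap_le (M.measurable_s k).comap_le
        (comap_measurable _).stronglyMeasurable hind).trans ?_
      rw [M.integral_disturbance t]
      rfl
    · rw [hl]
      exact hind
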